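/- Let $C$ be a smooth projective geometrically irreducible curve over a finite field $\mathbb{F}_q$ with a fixed rational point $\infty\in C(\mathbb{F}_q)$. Let $L\supset\mathbb{F}_q$ be a field, $C_L=C\times_{\mathbb{F}_q}\operatorname{Spec}L$, let $\sigma=\mathrm{id}_C\times\operatorname{Spec}(\mathrm{Frob}_q)$ be the endomorphism of $C_L$ induced by $x\mapsto x^q$ on $L$, and let $c:\operatorname{Spec}L\to C$ be an $\mathbb{F}_q$-morphism whose graph has ideal sheaf $\mathcal{I}$ on $C_L$. An abelian $\tau$-sheaf $\underline{\mathcal F}=(\mathcal F_i,\Pi_i,\tau_i)_{i\in\mathbb Z}$ of rank $r\ge 0$, dimension $d\ge 0$ and characteristic $c$ over $L$ consists of locally free sheaves $\mathcal F_i$ of rank $r$ on $C_L$ and injective $\mathcal O_{C_L}$-linear maps $\Pi_i:\mathcal F_i\to\mathcal F_{i+1}$, $\tau_i:\sigma^*\mathcal F_i\to\mathcal F_{i+1}$ $(i\in\mathbb Z)$ such that: (1) $\Pi_{i+1}\circ\tau_i=\tau_{i+1}\circ\sigma^*\Pi_i$ for all $i$; (2) there are integers $m,l>0$ with $ld=mr$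 such that, for all $i$, $\Pi_{i+l-1}\circ\cdots\circ\Pi_i$ identifies $\mathcal F_i$ with the subsheaf $\mathcal F_{i+l}(-m\cdot\infty)$ of $\mathcal F_{i+l}$; (3) $\dim_L\operatorname{coker}\Pi_i=d$ for all $i$; (4) $\operatorname{coker}\tau_i$ is annihilated by $\mathcal I^d$ and $\dim_L\operatorname{coker}\tau_i=d$ for all $i$. Its weight is $d/r$ if $\underline{\mathcal F}\neq 0$, and $0$ if $\underline{\mathcal F}=0$. A morphism $f:\underline{\mathcal F}\to\underline{\mathcal F}'$ between abelian $\tau$-sheaves of the same characteristic $c$ is a family of $\mathcal O_{C_L}$-linear maps $f_i:\mathcal F_i\to\mathcal F'_i$ with $f_{i+1}\circ\Pi_i=\Pi'_i\circ f_i$ and $f_{i+1}\circ\tau_i=\tau'_i\circ\sigma^*f_i$ for all $i$; it is called injective if all $f_i$ are injective. Proposition. Let $f:\underline{\mathcal F}\to\underline{\mathcal F}'$ be a morphism between two abelian $\tau$-sheaves of characteristic $c$ over $L$. The following assertions are equivalent: (a) $f$ is injective, and there is a finite closed subset $D\subset C$ such that the support of $\operatorname{coker}f_i$ is contained in $D\times\operatorname{Spec}L$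 for all $i\in\mathbb Z$; (b) $f$ is injective, and $\underline{\mathcal F}$ and $\underline{\mathcal F}'$ have the same rank and the same dimension; (c) $\underline{\mathcal F}$ and $\underline{\mathcal F}'$ have the same weight, and the fiber $f_{i,\eta}$ at the generic point $\eta$ of $C_L$ is an isomorphism for some $i\in\mathbb Z$; (c') $\underline{\mathcal F}$ and $\underline{\mathcal F}'$ have the same weight, and $f_{i,\eta}$ is an isomorphism for all $i\in\mathbb Z$. -/

import Mathlib

open CategoryTheory CategoryTheory.Limits AlgebraicGeometry

universe u

noncomputable section

/-- A smooth proper (equivalently, for curves: smooth projective) geometrically irreducible curve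
`C` over the field `k`, together with a `k`-rational point `∞ ∈ C(k)`. -/
structure PointedCurve (k : Type u) [Field k] where
  /-- the curve -/
  C : Scheme.{u}
  /-- the structure morphism `C ⟶ Spec k` -/
  str : C ⟶ Spec (.of k)
  smooth : SmoothOfRelativeDimension 1 str
  proper : IsProper str
  geomIrred : GeometricallyIrreducible str
  /-- the rational point `∞` -/
  infty : Spec (.of k) ⟶ C
  infty_str : infty ≫ str = 𝟙 _

namespace PointedCurve

variable {k : Type u} [Field k] (X : PointedCurve k) (L : Type u) [Field L] [Algebra k L]

/-- The morphism `Spec L ⟶ Spec k`. -/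
abbrev baseMap (k L : Type u) [Field k] [Field L] [Algebra k L] :
    Spec (.of L) ⟶ Spec (.of k) :=
  Spec.map (CommRingCat.ofHom (algebraMap k L))

/-- `C_L = C ×_{Spec k} Spec L`. -/
abbrev CL : Scheme.{u} := pullback X.str (baseMap k L)

/-- The projection `C_L ⟶ C`. -/
abbrev toC : X.CL L ⟶ X.C := pullback.fst _ _

/-- The projection `C_L ⟶ Spec L`. -/
abbrev toSpec : X.CL L ⟶ Spec (.of L) := pullback.snd _ _

instance irreducibleSpace_CL : IrreducibleSpace (X.CL L) := by
  have := X.smooth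
  have := X.geomIrred
  have : Smooth X.str := SmoothOfRelativeDimension.smooth 1 X.str
  infer_instance

/-- The `q`-Frobenius `Spec L ⟶ Spec L`, where `q = #k`. -/
def frobSpec (k L : Type u) [Field k] [Fintype k] [Field L] [Algebra k L] :
    Spec (.of L) ⟶ Spec (.of L) :=
  Spec.map (CommRingCat.ofHom (FiniteField.frobeniusAlgHom k L).toRingHom)

lemma frobSpec_baseMap (k L : Type u) [Field k] [Fintype k] [Field L] [Algebra k L] :
    frobSpec k L ≫ baseMap k L = baseMap k L := by
  rw [frobSpec, baseMap, ← Spec.map_comp, ← CommRingCat.ofHom_comp]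
  congr 2
  exact (FiniteField.frobeniusAlgHom k L).comp_algebraMap

/-- `σ = id_C × Spec (Frob_q) : C_L ⟶ C_L`. -/
def sigma [Fintype k] : X.CL L ⟶ X.CL L :=
  pullback.lift (X.toC L) (X.toSpec L ≫ frobSpec k L) (by
    rw [Category.assoc, frobSpec_baseMap, pullback.condition])

/-- Morphisms `Spec L ⟶ C` over `Spec k`. -/
structure Point where
  /-- the morphism `Spec L ⟶ C` -/
  hom : Spec (.of L) ⟶ X.C
  hom_str : hom ≫ X.str = baseMap k L

/-- The point `∞`, considered as an `L`-valued point of `C`. -/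
def inftyPoint : X.Point L where
  hom := baseMap k L ≫ X.infty
  hom_str := by rw [Category.assoc, X.infty_str, Category.comp_id]

variable {X L}

/-- The graph `Spec L ⟶ C_L` of a morphism `c : Spec L ⟶ C` over `k`. -/
def Point.graph (c : X.Point L) : Spec (.of L) ⟶ X.CL L :=
  pullback.lift c.hom (𝟙 _) (by rw [c.hom_str, Category.id_comp])

/-- The ideal sheaf on `C_L` of the graph of `c : Spec L ⟶ C`.  For `c = ∞` this is the ideal
sheaf `𝒪(-∞)` of the divisor `∞` on `C_L`. -/
def Point.graphIdeal (c : X.Point L) : (X.CL L).IdealSheafData := Scheme.Hom.ker c.graph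

/-- The `𝒪_{C_L}`-module `M` has `L`-dimension `d`, i.e. its global sections form a
`d`-dimensional `L`-vector space.  This is used for torsion sheaves `M`, which are identified with
their finite-dimensional `L`-vector spaces of global sections. -/
def HasDim (M : (X.CL L).Modules) (d : ℕ) : Prop :=
  letI : Module L Γ(M, ⊤) := Module.compHom Γ(M, ⊤)
    ((Scheme.ΓSpecIso (.of L)).inv ≫ (X.toSpec L).appTop).hom
  Module.rank L Γ(M, ⊤) = d

end PointedCurve

namespace ModulesAux

variable {Y : Scheme.{u}}

/-- `M` is locally free of rank `r`: locally isomorphic to `𝒪^r`. -/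
def IsLocallyFreeOfRank (M : Y.Modules) (r : ℕ) : Prop :=
  ∀ x : Y, ∃ U : Y.Opens, x ∈ U ∧ Nonempty (M.restrict U.ι ≅
    (SheafOfModules.free (R := U.toScheme.ringCatSheaf) (ULift.{u} (Fin r)) : U.toScheme.Modules))

/-- `M` is annihilated by the ideal sheaf `I`. -/
def IsAnnihilatedBy (M : Y.Modules) (I : Y.IdealSheafData) : Prop :=
  ∀ U : Y.affineOpens, ∀ a ∈ I.ideal U, ∀ s : Γ(M, U.1), a • s = 0

/-- The image of `φ : M ⟶ N` is the subsheaf `I N` of `N`.  It is meant for quasi-coherent sheaves,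
so it suffices to look at sections over affine opens `U`, where `(I N)(U) = I(U) N(U)`. -/
def ImageEqIdealMul {M N : Y.Modules} (φ : M ⟶ N) (I : Y.IdealSheafData) : Prop :=
  ∀ (U : Y.affineOpens) (s : Γ(N, U.1)),
    (∃ t : Γ(M, U.1), φ.app U.1 t = s) ↔ s ∈ I.ideal U • (⊤ : Submodule Γ(Y, U.1) Γ(N, U.1))

/-- The map induced on the stalks at `x` by a morphism of `𝒪_Y`-modules. -/
def stalkMap {M N : Y.Modules} (φ : M ⟶ N) (x : Y) :
    M.presheaf.stalk x ⟶ N.presheaf.stalk x :=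
  (TopCat.Presheaf.stalkFunctor Ab x).map φ.mapPresheaf

/-- The support of `M`: the set of points with non-zero stalk. -/
def support (M : Y.Modules) : Set Y := {x | Nontrivial (M.presheaf.stalk x)}

end ModulesAux

open ModulesAux PointedCurve

/-- An abelian `τ`-sheaf of characteristic `c : Spec L ⟶ C` over `L`.

The sheaves `ℱ_i` and the maps `Π_i : ℱ_i ⟶ ℱ_{i+1}` (`i ∈ ℤ`) are given as a functor `ℱ` on the
ordered set `ℤ`: `Π_i` is the value of `ℱ` at `i ≤ i + 1`, and the composite
`Π_{i+l-1} ∘ ⋯ ∘ Π_i : ℱ_i ⟶ ℱ_{i+l}` is its value at `i ≤ i + l`. -/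
structure AbelianTauSheaf {k : Type u} [Field k] [Fintype k] {X : PointedCurve k}
    {L : Type u} [Field L] [Algebra k L] (c : X.Point L) where
  /-- the rank `r` -/
  rank : ℕ
  /-- the dimension `d` -/
  dim : ℕ
  /-- the sequence of sheaves `ℱ_i` with the maps `Π_i` -/
  sheaf : ℤ ⥤ (X.CL L).Modules
  /-- the maps `τ_i : σ^* ℱ_i ⟶ ℱ_{i+1}` -/
  tau : ∀ i : ℤ, (Scheme.Modules.pullback (X.sigma L)).obj (sheaf.obj i) ⟶ sheaf.obj (i + 1)
  locallyFree : ∀ i, IsLocallyFreeOfRank (sheaf.obj i) rank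
  pi_injective : ∀ i : ℤ, Mono (sheaf.map (homOfLE (Int.le_add_one le_rfl : i ≤ i + 1)))
  tau_injective : ∀ i : ℤ, Mono (tau i)
  /-- `Π_{i+1} ∘ τ_i = τ_{i+1} ∘ σ^* Π_i` -/
  tau_pi : ∀ i : ℤ,
    tau i ≫ sheaf.map (homOfLE (Int.le_add_one le_rfl : i + 1 ≤ i + 1 + 1)) =
      (Scheme.Modules.pullback (X.sigma L)).map
        (sheaf.map (homOfLE (Int.le_add_one le_rfl : i ≤ i + 1))) ≫ tau (i + 1)
  /-- `Π_{i+l-1} ∘ ⋯ ∘ Π_i` identifies `ℱ_i` with the subsheaf `ℱ_{i+l}(-k∞)` of `ℱ_{i+l}` -/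
  periodic : ∃ m l : ℕ, 0 < m ∧ 0 < l ∧ l * dim = m * rank ∧
    ∀ i : ℤ, ImageEqIdealMul
      (sheaf.map (homOfLE (Int.le_add_of_nonneg_right (Int.natCast_nonneg l) : i ≤ i + l)))
      ((X.inftyPoint L).graphIdeal ^ m)
  pi_coker : ∀ i : ℤ,
    HasDim (cokernel (sheaf.map (homOfLE (Int.le_add_one le_rfl : i ≤ i + 1)))) dim
  tau_coker_annihilated : ∀ i : ℤ, IsAnnihilatedBy (cokernel (tau i)) (c.graphIdeal ^ dim)
  tau_coker : ∀ i : ℤ, HasDim (cokernel (tau i)) dim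

namespace AbelianTauSheaf

variable {k : Type u} [Field k] [Fintype k] {X : PointedCurve k}
  {L : Type u} [Field L] [Algebra k L] {c : X.Point L}

open Classical in
/-- The weight: `d / r` if `ℱ ≠ 0` and `0` if `ℱ = 0`. -/
def weight (F : AbelianTauSheaf c) : ℚ :=
  if ∀ i, IsZero (F.sheaf.obj i) then 0 else (F.dim : ℚ) / (F.rank : ℚ)

/-- Morphisms of abelian `τ`-sheaves: families `f_i : ℱ_i ⟶ ℱ'_i` commuting with the `Π`'s
and the `τ`'s. -/
structure Hom (F F' : AbelianTauSheaf c) where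
  /-- the maps `f_i` -/
  app : ∀ i : ℤ, F.sheaf.obj i ⟶ F'.sheaf.obj i
  pi_comm : ∀ i : ℤ,
    F.sheaf.map (homOfLE (Int.le_add_one le_rfl : i ≤ i + 1)) ≫ app (i + 1) =
      app i ≫ F'.sheaf.map (homOfLE (Int.le_add_one le_rfl : i ≤ i + 1))
  tau_comm : ∀ i : ℤ,
    F.tau i ≫ app (i + 1) =
      (Scheme.Modules.pullback (X.sigma L)).map (app i) ≫ F'.tau i

/-- `f` is injective if all `f_i` are injective. -/
def Hom.Injective {F F' : AbelianTauSheaf c} (f : Hom F F') : Prop := ∀ i, Mono (f.app i)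

/-- The fiber `f_{i,η}` at the generic point `η` of the integral scheme `C_L`, which is the map on
stalks at `η` since the local ring at `η` is the residue field. -/
def Hom.genericFiber {F F' : AbelianTauSheaf c} (f : Hom F F') (i : ℤ) :
    (F.sheaf.obj i).presheaf.stalk (genericPoint (X.CL L)) ⟶
      (F'.sheaf.obj i).presheaf.stalk (genericPoint (X.CL L)) :=
  stalkMap (f.app i) (genericPoint (X.CL L))

end AbelianTauSheaf

end

noncomputable section

/-! ### Stalks of sheaves of modules: linear structure and exactness. -/

namespace ModulesAux

open TopologicalSpace Opposite

variable {Y : Scheme.{u}}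

/-! Everything reduces to injective `f` between sheaves of equal rank. Periodicity makes the `Π_i`
isomorphisms away from `∞`, so the behaviour of `f_i` there does not depend on `i`. At the generic
point `η` the stalks are vector spaces over the function field: ranks can be compared there, an
injective map of equal ranks is bijective, and stalks of locally free sheaves embed into the stalk
at `η`, so injectivity can be tested there. A finite `D` cannot contain the image of `η`, because
`C` is infinite.

Equal rank forces equal dimension (`Hom.dim_eq`). Let `I` be the ideal of `∞` in the local ring of
`C_L` there, and `δ_i` the determinant of `f_i` on stalks. By periodicity the determinant of `ℱ_i →
ℱ_{i+l}` generates `I^(mr)`, where `mr = ld`. If the dimensions differed, commutation with the `Π_i`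
would give `δ_{i+e} ∈ I δ_i` for a fixed `e` and all `i`, so `δ_i` would lie in every power of `I`
and vanish by Krull (`slope_eq`), against injectivity.

The cokernels live over a finite `D` (`PointedCurve.exists_finite_isClosed`). Let `S` be the locus
where `f_0` is not surjective. Off `∞` and the graph of `c`, the maps `τ_i` together with
`surjective_pullback_iff` show that `x ∈ S` iff `σ x ∈ S`. On a chart `Spec B`, `B = A ⊗ L`, the set
`S` is finite and `σ` is bijective, so `σ` maps `S` to itself. If `I` is now the ideal of `S`, then
`σ` acts Frobenius-semilinearly on the finite-dimensional `B/I` and fixes the image of `A`. Fixed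
vectors independent over `𝔽_q` stay independent over `L`, so that image is finite and the points of
`S` lie over closed points of `C`. -/

instance stalkModule (M : Y.Modules) (x : Y) :
    Module (Y.presheaf.stalk x) (M.presheaf.stalk x) :=
  inferInstanceAs (Module (Y.presheaf.stalk x : CommRingCat.{u})
    (TopCat.Presheaf.stalk (C := Ab.{u})
      (show PresheafOfModules.{u} (Y.presheaf ⋙ forget₂ CommRingCat.{u} RingCat.{u}) from
        M.val).presheaf x : Ab.{u}))

lemma germ_smul (M : Y.Modules) (x : Y) (U : Y.Opens) (hx : x ∈ U) (r : Γ(Y, U)) (m : Γ(M, U)) :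
    M.presheaf.germ U x hx (r • m) = Y.presheaf.germ U x hx r • M.presheaf.germ U x hx m :=
  PresheafOfModules.germ_smul (R := Y.presheaf) M.val x U hx r m

@[simp]
lemma stalkMap_germ {M N : Y.Modules} (φ : M ⟶ N) (x : Y) (U : Y.Opens) (hx : x ∈ U)
    (s : Γ(M, U)) :
    stalkMap φ x (M.presheaf.germ U x hx s) = N.presheaf.germ U x hx (φ.app U s) :=
  TopCat.Presheaf.stalkFunctor_map_germ_apply U x hx φ.mapPresheaf s

lemma stalkMap_smul {M N : Y.Modules} (φ : M ⟶ N) (x : Y) (a : Y.presheaf.stalk x)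
    (m : M.presheaf.stalk x) : stalkMap φ x (a • m) = a • stalkMap φ x m := by
  obtain ⟨U, hxU, s, rfl⟩ := M.presheaf.exists_germ_eq m
  obtain ⟨V, hVU, hxV, b, rfl⟩ := Y.presheaf.exists_le_germ_eq a hxU
  rw [← M.presheaf.germ_res_apply (homOfLE hVU) x hxV, ← germ_smul, stalkMap_germ,
    stalkMap_germ, Scheme.Modules.Hom.app_smul, germ_smul]

/-- The map on stalks, as a linear map. -/
def stalkLin {M N : Y.Modules} (φ : M ⟶ N) (x : Y) :
    M.presheaf.stalk x →ₗ[Y.presheaf.stalk x] N.presheaf.stalk x where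
  toFun := stalkMap φ x
  map_add' := map_add (stalkMap φ x).hom
  map_smul' := stalkMap_smul φ x

@[simp]
lemma stalkLin_apply {M N : Y.Modules} (φ : M ⟶ N) (x : Y) (m : M.presheaf.stalk x) :
    stalkLin φ x m = stalkMap φ x m := rfl

variable {M N K : Y.Modules}

/-- The underlying sheaf of abelian groups. -/
def toSheafAb (Y : Scheme.{u}) : Y.Modules ⥤ TopCat.Sheaf Ab.{u} Y :=
  SheafOfModules.toSheaf Y.ringCatSheaf

instance : PreservesFiniteLimits (toSheafAb Y) :=
  inferInstanceAs (PreservesFiniteLimits (SheafOfModules.toSheaf.{u} Y.ringCatSheaf))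

/-- Sheafifying the underlying diagram of presheaves gives back `G`, so its colimit is a sheafified
presheaf colimit, and those are preserved. This is what makes stalks right exact. -/
lemma preservesColimit_toSheaf {J : Type} [SmallCategory J]
    (R : Sheaf (Opens.grothendieckTopology Y) RingCat.{u}) (G : J ⥤ SheafOfModules.{u} R)
    [HasColimitsOfShape J AddCommGrpCat.{u}] :
    PreservesColimit G (SheafOfModules.toSheaf.{u} R) := by
  let adj := PresheafOfModules.sheafificationAdjunction.{u} (𝟙 R.obj)
  let L := PresheafOfModules.sheafification.{u} (𝟙 R.obj)
  let Rf := SheafOfModules.forget.{u} R ⋙ PresheafOfModules.restrictScalars (𝟙 R.obj)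
  let K := G ⋙ Rf
  have hcomp : PreservesColimit K (L ⋙ SheafOfModules.toSheaf.{u} R) := by
    change PreservesColimit K (PresheafOfModules.toPresheaf.{u} R.obj ⋙
      presheafToSheaf (Opens.grothendieckTopology Y) AddCommGrpCat)
    infer_instance
  have hc : IsColimit (L.mapCocone (colimit.cocone K)) :=
    isColimitOfPreserves L (colimit.isColimit K)
  have h1 : PreservesColimit (K ⋙ L) (SheafOfModules.toSheaf.{u} R) :=
    preservesColimit_of_preserves_colimit_cocone hc
      (isColimitOfPreserves (L ⋙ SheafOfModules.toSheaf.{u} R) (colimit.isColimit K))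
  exact preservesColimit_of_iso_diagram _
    (show K ⋙ L ≅ G from Functor.isoWhiskerLeft G (asIso adj.counit))

instance preservesFiniteColimits_toSheafAb : PreservesFiniteColimits (toSheafAb Y) where
  preservesFiniteColimits _ _ _ :=
    ⟨fun {K} => preservesColimit_toSheaf Y.ringCatSheaf K⟩

/-- The stalk functor on modules. -/
def stalkFun (x : Y) : Y.Modules ⥤ Ab.{u} :=
  toSheafAb Y ⋙ (TopCat.Sheaf.forget Ab.{u} Y ⋙ TopCat.Presheaf.stalkFunctor Ab.{u} x)

lemma stalkMap_comp (φ : M ⟶ N) (ψ : N ⟶ K) (x : Y) :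
    stalkMap (φ ≫ ψ) x = stalkMap φ x ≫ stalkMap ψ x :=
  (stalkFun x).map_comp φ ψ

lemma stalkMap_comp_apply (φ : M ⟶ N) (ψ : N ⟶ K) (x : Y) (m : M.presheaf.stalk x) :
    stalkMap (φ ≫ ψ) x m = stalkMap ψ x (stalkMap φ x m) := by
  rw [stalkMap_comp]; rfl

lemma section_ext {U : Y.Opens} {s t : Γ(M, U)}
    (h : ∀ x (hx : x ∈ U), M.presheaf.germ U x hx s = M.presheaf.germ U x hx t) : s = t :=
  TopCat.Presheaf.section_ext ⟨M.presheaf, M.isSheaf⟩ U s t h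

instance (x : Y) : PreservesFiniteLimits (stalkFun x) :=
  comp_preservesFiniteLimits (toSheafAb Y) _

instance (x : Y) : PreservesFiniteColimits (stalkFun x) :=
  comp_preservesFiniteColimits (toSheafAb Y)
    (TopCat.Sheaf.forget Ab.{u} Y ⋙ TopCat.Presheaf.stalkFunctor Ab.{u} x)

lemma stalkMap_injective_of_mono (φ : M ⟶ N) [Mono φ] (x : Y) :
    Function.Injective (stalkMap φ x) := by
  have : Mono ((stalkFun x).map φ) := inferInstance
  exact (AddCommGrpCat.mono_iff_injective _).1 this

lemma mono_of_stalkMap_injective (φ : M ⟶ N) (h : ∀ x, Function.Injective (stalkMap φ x)) :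
    Mono φ := by
  refine ⟨fun {K} g g' hg => ?_⟩
  ext U s
  refine section_ext fun x hx => h x ?_
  rw [← stalkMap_germ, ← stalkMap_germ, ← stalkMap_comp_apply, ← stalkMap_comp_apply, hg]

/-- Taking stalks is exact, hence commutes with cokernels. From here on supports of cokernels are
handled as loci of non-surjectivity. -/
lemma notMem_support_cokernel_iff (φ : M ⟶ N) (x : Y) :
    x ∉ support (cokernel φ) ↔ Function.Surjective (stalkMap φ x) := by
  have h1 : x ∉ support (cokernel φ) ↔ IsZero ((stalkFun x).obj (cokernel φ)) := by
    rw [support, Set.mem_ofPred_eq, not_nontrivial_iff_subsingleton]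
    exact ⟨fun h => @AddCommGrpCat.isZero_of_subsingleton _ h,
      fun h => AddCommGrpCat.subsingleton_of_isZero h⟩
  rw [h1, (PreservesCokernel.iso (stalkFun x) φ).isZero_iff,
    ← Preadditive.epi_iff_isZero_cokernel, AddCommGrpCat.epi_iff_surjective]
  rfl

end ModulesAux

/-! ### Trivializations, frames, and bases of stalks of locally free sheaves. -/

namespace ModulesAux

open TopologicalSpace Opposite

variable {Y : Scheme.{u}} {M N : Y.Modules} {r : ℕ}

/-- The structure sheaf as a module over itself. -/
abbrev unitModule (Y : Scheme.{u}) : Y.Modules := SheafOfModules.unit Y.ringCatSheaf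

/-- An element of `Γ(Y, U)` as a section of the structure sheaf. -/
abbrev unitSection {U : Y.Opens} (a : Γ(Y, U)) : Γ(unitModule Y, U) := a

/-- A global trivialization of `M`, presented as a decomposition into copies of `𝒪`. -/
structure Trivialization (M : Y.Modules) (r : ℕ) where
  ι : Fin r → (unitModule Y ⟶ M)
  π : Fin r → (M ⟶ unitModule Y)
  ι_π : ∀ i j, ι i ≫ π j = if i = j then 𝟙 _ else 0
  sum_π_ι : ∑ j, π j ≫ ι j = 𝟙 M

/-- The tautological trivialization of a coproduct of copies of `𝒪`. -/
def Trivialization.sigma (Y : Scheme.{u}) (r : ℕ) :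
    Trivialization (∐ fun _ : ULift.{u} (Fin r) => unitModule Y) r where
  ι j := Sigma.ι (fun _ : ULift.{u} (Fin r) => unitModule Y) (ULift.up j)
  π j := Sigma.desc (fun i => if i.down = j then 𝟙 _ else 0)
  ι_π i j := Sigma.ι_desc _ _
  sum_π_ι := by
    refine Sigma.hom_ext _ _ fun i => ?_
    rw [Preadditive.comp_sum, Finset.sum_eq_single i.down]
    · rw [← Category.assoc, Sigma.ι_desc, if_pos rfl, Category.id_comp, Category.comp_id]
    · intro j _ hj
      rw [← Category.assoc, Sigma.ι_desc, if_neg hj.symm, zero_comp]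
    · simp

/-- The tautological trivialization of a free module. -/
def Trivialization.free (Y : Scheme.{u}) (r : ℕ) :
    Trivialization (SheafOfModules.free (R := Y.ringCatSheaf) (ULift.{u} (Fin r)) : Y.Modules) r :=
  Trivialization.sigma Y r

/-- Transport of a trivialization along an isomorphism. -/
def Trivialization.ofIso (T : Trivialization M r) (e : N ≅ M) : Trivialization N r where
  ι j := T.ι j ≫ e.inv
  π j := e.hom ≫ T.π j
  ι_π i j := by simp [T.ι_π]
  sum_π_ι := by
    have := congr(e.hom ≫ $(T.sum_π_ι) ≫ e.inv)
    simpa [Preadditive.comp_sum, Preadditive.sum_comp] using this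

lemma unit_hom_app (h : unitModule Y ⟶ M) {V : Y.Opens} (a : Γ(Y, V)) :
    h.app V (unitSection a) = a • M.presheaf.map (homOfLE le_top).op (h.app ⊤ (unitSection 1)) := by
  have h1 : h.app V (unitSection 1) =
      M.presheaf.map (homOfLE le_top).op (h.app ⊤ (unitSection 1)) := by
    have := ConcreteCategory.congr_hom (h.mapPresheaf.naturality (homOfLE (le_top : V ≤ ⊤)).op)
      (unitSection 1)
    refine Eq.trans ?_ this
    change h.app V (unitSection 1) = h.app V (unitSection (Y.presheaf.map _ 1))
    rw [map_one]
  rw [← h1, ← Scheme.Modules.Hom.app_smul]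
  congr 1
  exact (mul_one a).symm

lemma hom_app_sum {ι : Type*} (s : Finset ι) (h : ι → (M ⟶ N)) (V : Y.Opens) (x : Γ(M, V)) :
    (∑ i ∈ s, h i).app V x = ∑ i ∈ s, (h i).app V x := by
  classical
  induction s using Finset.induction_on with
  | empty => rfl
  | insert a s ha ih => rw [Finset.sum_insert ha, Finset.sum_insert ha, ← ih]; rfl

/-- The sections `e` freely generate `M` over `U`. -/
def IsFrame (M : Y.Modules) (U : Y.Opens) (e : Fin r → Γ(M, U)) : Prop :=
  ∀ (V : Y.Opens) (h : V ≤ U), Function.Bijective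
    fun a : Fin r → Γ(Y, V) => ∑ j, a j • M.presheaf.map (homOfLE h).op (e j)

lemma Trivialization.isFrame (T : Trivialization M r) :
    IsFrame M ⊤ fun j => (T.ι j).app ⊤ (unitSection 1) := by
  intro V _
  have key (a : Fin r → Γ(Y, V)) :
      ∑ j, a j • M.presheaf.map (homOfLE le_top).op ((T.ι j).app ⊤ (unitSection 1)) =
        ∑ j, (T.ι j).app V (unitSection (a j)) :=
    Finset.sum_congr rfl fun j _ => (unit_hom_app _ _).symm
  constructor
  · intro a b hab
    dsimp only at hab
    rw [key, key] at hab
    funext i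
    have (c : Fin r → Γ(Y, V)) :
        (T.π i).app V (∑ j, (T.ι j).app V (unitSection (c j))) = unitSection (c i) := by
      rw [map_sum, Finset.sum_eq_single i]
      · change (T.ι i ≫ T.π i).app V _ = _
        rw [T.ι_π, if_pos rfl]; rfl
      · intro j _ hj
        change (T.ι j ≫ T.π i).app V _ = _
        rw [T.ι_π, if_neg hj]; rfl
      · simp
    exact (this a).symm.trans ((congrArg _ hab).trans (this b))
  · intro s
    have := congr(($(T.sum_π_ι)).app V s)
    rw [hom_app_sum] at this
    exact ⟨fun j => (T.π j).app V s, (key _).trans this⟩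

/-- Opens inside the range of `f` are exactly the images `f ''ᵁ W`; there only the scalars change,
through the ring isomorphism `f.appIso W`. -/
lemma IsFrame.of_restrict {X : Scheme.{u}} (f : X ⟶ Y) [IsOpenImmersion f]
    {e : Fin r → Γ(M.restrict f, ⊤)} (he : IsFrame (M.restrict f) ⊤ e) :
    IsFrame M (f ''ᵁ ⊤) (fun j => (M.restrictAppIso f ⊤).hom (e j)) := by
  intro V hV
  obtain ⟨W, rfl⟩ : ∃ W : X.Opens, V = f ''ᵁ W :=
    ⟨f ⁻¹ᵁ V, (by
      rw [Scheme.Hom.image_preimage_eq_opensRange_inf]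
      rw [Scheme.Hom.image_top_eq_opensRange] at hV
      exact (inf_eq_right.2 hV).symm)⟩
  have h := he W le_top
  have h2 : Function.Bijective fun a : Fin r → Γ(Y, f ''ᵁ W) => fun j => (f.appIso W).hom (a j) :=
    (Equiv.piCongrRight fun _ : Fin r =>
      ((f.appIso W).commRingCatIsoToRingEquiv).toEquiv).bijective
  refine (congrArg Function.Bijective (?_ : _ = _)).mpr (h.comp h2)
  funext a
  refine Finset.sum_congr rfl fun j _ => ?_
  change _ = (f.appIso W).inv ((f.appIso W).hom (a j)) •
    M.presheaf.map (homOfLE hV).op ((M.restrictAppIso f ⊤).hom (e j))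
  rw [← CommRingCat.comp_apply, Iso.hom_inv_id, CommRingCat.id_apply]

lemma IsLocallyFreeOfRank.exists_isFrame (hM : IsLocallyFreeOfRank M r) (x : Y) :
    ∃ (U : Y.Opens) (e : Fin r → Γ(M, U)), x ∈ U ∧ IsFrame M U e := by
  obtain ⟨U, hx, ⟨i⟩⟩ := hM x
  refine ⟨U.ι ''ᵁ ⊤, _, by simpa using hx,
    IsFrame.of_restrict U.ι (((Trivialization.free _ r).ofIso i).isFrame)⟩

variable {U : Y.Opens} {e : Fin r → Γ(M, U)}

lemma exists_germ_eq_of_fin (x : Y) (U : Y.Opens) (hx : x ∈ U) (g : Fin r → Y.presheaf.stalk x) :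
    ∃ (V : Y.Opens) (_ : V ≤ U) (hxV : x ∈ V) (b : Fin r → Γ(Y, V)),
      ∀ j, Y.presheaf.germ V x hxV (b j) = g j := by
  choose W hWU hxW b hb using fun j => Y.presheaf.exists_le_germ_eq (g j) hx
  have hmem : x ∈ Finset.univ.inf W := by
    rw [← SetLike.mem_coe, Opens.coe_finset_inf]
    simpa using hxW
  have hxV : x ∈ U ⊓ Finset.univ.inf W := Opens.mem_inf.2 ⟨hx, hmem⟩
  refine ⟨U ⊓ Finset.univ.inf W, inf_le_left, hxV, fun j => Y.presheaf.map
    (homOfLE (inf_le_right.trans (Finset.inf_le (Finset.mem_univ j)))).op (b j), fun j => ?_⟩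
  exact (Y.presheaf.germ_res_apply _ x hxV (b j)).trans (hb j)

/-- The basis of a stalk induced by a frame. -/
def IsFrame.basis (he : IsFrame M U e) (x : Y) (hx : x ∈ U) :
    Module.Basis (Fin r) (Y.presheaf.stalk x) (M.presheaf.stalk x) :=
  Module.Basis.mk (v := fun j => M.presheaf.germ U x hx (e j)) (by
    -- A relation between germs already holds between sections over some smaller `W`, where the
    -- frame property kills the coefficients.
    rw [Fintype.linearIndependent_iff]
    intro g hg
    obtain ⟨V, hVU, hxV, b, hb⟩ := exists_germ_eq_of_fin x U hx g
    have h0 : M.presheaf.germ V x hxV (∑ j, b j • M.presheaf.map (homOfLE hVU).op (e j)) =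
        M.presheaf.germ V x hxV 0 := by
      rw [map_sum, map_zero, ← hg]
      refine Finset.sum_congr rfl fun j _ => ?_
      rw [germ_smul, TopCat.Presheaf.germ_res_apply, hb]
    obtain ⟨W, hxW, i, i', hW⟩ := M.presheaf.germ_eq x hxV hxV _ _ h0
    have h1 := (he W (i.le.trans hVU)).1 (a₁ := fun j => Y.presheaf.map i.op (b j)) (a₂ := 0) (by
      dsimp only
      simp only [Pi.zero_apply, zero_smul, Finset.sum_const_zero]
      rw [map_zero, map_sum] at hW
      rw [← hW]
      refine Finset.sum_congr rfl fun j _ => ?_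
      rw [Scheme.Modules.map_smul, ← CategoryTheory.comp_apply, ← Functor.map_comp]
      rfl)
    intro j
    rw [← hb, ← TopCat.Presheaf.germ_res_apply _ i x hxW, show Y.presheaf.map i.op (b j) = 0 from
      congrFun h1 j, map_zero]) (by
    rintro m -
    obtain ⟨V, hVU, hxV, s, rfl⟩ := M.presheaf.exists_le_germ_eq m hx
    obtain ⟨a, rfl⟩ := (he V hVU).2 s
    dsimp only
    rw [map_sum]
    refine Submodule.sum_mem _ fun j _ => ?_
    rw [germ_smul, TopCat.Presheaf.germ_res_apply]
    exact Submodule.smul_mem _ _ (Submodule.subset_span ⟨j, rfl⟩))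

lemma IsFrame.basis_apply (he : IsFrame M U e) (x : Y) (hx : x ∈ U) (j : Fin r) :
    he.basis x hx j = M.presheaf.germ U x hx (e j) := by
  simp [IsFrame.basis]

/-- A basis of the stalk of a locally free module. -/
def IsLocallyFreeOfRank.basis (hM : IsLocallyFreeOfRank M r) (x : Y) :
    Module.Basis (Fin r) (Y.presheaf.stalk x) (M.presheaf.stalk x) :=
  (hM.exists_isFrame x).choose_spec.choose_spec.2.basis x
    (hM.exists_isFrame x).choose_spec.choose_spec.1

/-- One frame around `x` gives bases at both `x` and `y`, so the claim can be checked coefficient by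
coefficient in the structure sheaf. -/
lemma IsLocallyFreeOfRank.injective_specialize (hM : IsLocallyFreeOfRank M r) {x y : Y}
    (h : y ⤳ x) (hY : Function.Injective (Y.presheaf.stalkSpecializes h)) :
    Function.Injective (M.presheaf.stalkSpecializes h) := by
  obtain ⟨U, e, hx, he⟩ := hM.exists_isFrame x
  have hy : y ∈ U := h.mem_open U.2 hx
  rw [injective_iff_map_eq_zero]
  intro m hm
  obtain ⟨V, hVU, hxV, s, rfl⟩ := M.presheaf.exists_le_germ_eq m hx
  have hyV : y ∈ V := h.mem_open V.2 hxV
  obtain ⟨a, rfl⟩ := (he V hVU).2 s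
  rw [TopCat.Presheaf.germ_stalkSpecializes_apply] at hm
  dsimp only at hm ⊢
  have key (z : Y) (hz : z ∈ V) : M.presheaf.germ V z hz (∑ j, a j •
      M.presheaf.map (homOfLE hVU).op (e j)) =
        ∑ j, Y.presheaf.germ V z hz (a j) • he.basis z (hVU hz) j := by
    rw [map_sum]
    refine Finset.sum_congr rfl fun j _ => ?_
    rw [germ_smul, TopCat.Presheaf.germ_res_apply, he.basis_apply]
  rw [key] at hm ⊢
  have h0 := Fintype.linearIndependent_iff.1 (he.basis y hy).linearIndependent _ hm
  refine Finset.sum_eq_zero fun j _ => ?_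
  have : Y.presheaf.germ V x hxV (a j) = 0 := hY (by
    rw [TopCat.Presheaf.germ_stalkSpecializes_apply, h0 j, map_zero])
  rw [this, zero_smul]

/-- A map between locally free modules which is surjective at a point is surjective nearby. -/
lemma exists_open_surjective_of_surjective (φ : M ⟶ N) (hN : IsLocallyFreeOfRank N r) (x : Y)
    (h : Function.Surjective (stalkMap φ x)) :
    ∃ U : Y.Opens, x ∈ U ∧ ∀ y ∈ U, Function.Surjective (stalkMap φ y) := by
  obtain ⟨U, e, hx, he⟩ := hN.exists_isFrame x
  choose m hm using fun j => h (N.presheaf.germ U x hx (e j))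
  choose W hWU hxW s hs using fun j => M.presheaf.exists_le_germ_eq (m j) hx
  have hW (j) : ∃ (V : Y.Opens) (hxV : x ∈ V) (h1 : V ≤ U) (h2 : V ≤ W j),
      N.presheaf.map (homOfLE h2).op (φ.app _ (s j)) = N.presheaf.map (homOfLE h1).op (e j) := by
    obtain ⟨V, hxV, i1, i2, h⟩ := N.presheaf.germ_eq x (hxW j) hx (φ.app _ (s j)) (e j) (by
      rw [← hm, ← hs, stalkMap_germ])
    exact ⟨V, hxV, i2.le, i1.le, h⟩
  choose V hxV h1 h2 hV using hW
  have hle (j) : U ⊓ Finset.univ.inf V ≤ V j :=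
    inf_le_right.trans (Finset.inf_le (Finset.mem_univ j))
  refine ⟨U ⊓ Finset.univ.inf V, ⟨hx, ?_⟩, fun y hy => ?_⟩
  · change x ∈ Finset.univ.inf V
    rw [← SetLike.mem_coe, Opens.coe_finset_inf]
    simpa using hxV
  change Function.Surjective (stalkLin φ y)
  rw [← LinearMap.range_eq_top, ← top_le_iff, ← (he.basis y hy.1).span_eq, Submodule.span_le]
  rintro _ ⟨j, rfl⟩
  refine ⟨M.presheaf.germ (W j) y (h2 j (hle j hy)) (s j), ?_⟩
  rw [stalkLin_apply, stalkMap_germ, he.basis_apply,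
    ← N.presheaf.germ_res_apply (homOfLE (h2 j)) y (hle j hy), hV,
    N.presheaf.germ_res_apply]

end ModulesAux

/-! ### Pullback of modules and surjectivity on stalks. -/

namespace ModulesAux

open TopologicalSpace Opposite

variable {X Y Z : Scheme.{u}} {M N : Y.Modules} {r : ℕ}

/-- Every object of the comma category maps to the one given by `⊤`. Finality is what makes the
pullback of the structure sheaf the structure sheaf. -/
instance final_opensMap (g : X ⟶ Y) : (Opens.map g.base).Final where
  out V := by
    let T : StructuredArrow V (Opens.map g.base) :=
      StructuredArrow.mk (Y := ⊤) (homOfLE le_top : V ⟶ (Opens.map g.base).obj ⊤)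
    have : Nonempty (StructuredArrow V (Opens.map g.base)) := ⟨T⟩
    refine zigzag_isConnected fun A B => ?_
    have h (A : StructuredArrow V (Opens.map g.base)) : Zag A T :=
      Or.inl ⟨StructuredArrow.homMk (homOfLE le_top) (Subsingleton.elim _ _)⟩
    exact (Relation.ReflTransGen.single (h A)).trans (Relation.ReflTransGen.single (h B).symm)

/-- The canonical map from the structure sheaf to the pushforward of the structure sheaf. -/
def unitToPushforward (g : X ⟶ Y) :
    unitModule Y ⟶ (Scheme.Modules.pushforward g).obj (unitModule X) :=
  SheafOfModules.unitToPushforwardObjUnit g.toRingCatSheafHom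

lemma unitToPushforward_app (g : X ⟶ Y) (U : Y.Opens) (a : Γ(Y, U)) :
    (unitToPushforward g).app U (unitSection a) = unitSection (g.app U a) := rfl

lemma isIso_pullbackObjUnitToUnit {C D : Type*} [Category* C] [Category* D]
    {J : GrothendieckTopology C} {K : GrothendieckTopology D} {F : C ⥤ D}
    {S : Sheaf J RingCat.{u}} {R : Sheaf K RingCat.{u}} [Functor.IsContinuous F J K]
    (φ : S ⟶ (F.sheafPushforwardContinuous RingCat.{u} J K).obj R)
    [(SheafOfModules.pushforward.{u} φ).IsRightAdjoint] (hF : F.Final) :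
    IsIso (SheafOfModules.pullbackObjUnitToUnit φ) :=
  inferInstance

lemma exists_pullbackUnitIso (g : X ⟶ Y) :
    ∃ e : (Scheme.Modules.pullback g).obj (unitModule Y) ≅ unitModule X,
      ((Scheme.Modules.pullbackPushforwardAdjunction g).homEquiv _ _) e.hom =
        unitToPushforward g := by
  have : ((SheafOfModules.pushforward.{u} g.toRingCatSheafHom)).IsRightAdjoint :=
    (Scheme.Modules.pullbackPushforwardAdjunction g).isRightAdjoint
  have h := isIso_pullbackObjUnitToUnit g.toRingCatSheafHom (final_opensMap g)
  let k : (Scheme.Modules.pullback g).obj (unitModule Y) ⟶ unitModule X :=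
    SheafOfModules.pullbackObjUnitToUnit g.toRingCatSheafHom
  have : IsIso k := h
  exact ⟨asIso k, SheafOfModules.pullbackPushforwardAdjunction_homEquiv_pullbackObjUnitToUnit
    g.toRingCatSheafHom⟩

/-- The pullback of the structure sheaf is the structure sheaf. -/
def pullbackUnitIso (g : X ⟶ Y) :
    (Scheme.Modules.pullback g).obj (unitModule Y) ≅ unitModule X :=
  (exists_pullbackUnitIso g).choose

/-- An endomorphism of `𝒪` is multiplication by a function `a`; its pullback is multiplication by
`g.app ⊤ a`. Under the adjunction the unit isomorphism becomes the comorphism of `g`, where this is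
visible. -/
lemma pullbackUnitIso_conj_app (g : X ⟶ Y) (h : unitModule Y ⟶ unitModule Y) :
    ((pullbackUnitIso g).inv ≫ (Scheme.Modules.pullback g).map h ≫ (pullbackUnitIso g).hom).app ⊤
      (unitSection 1) = unitSection (g.app ⊤ (h.app ⊤ (unitSection 1))) := by
  set h' := (pullbackUnitIso g).inv ≫ (Scheme.Modules.pullback g).map h ≫ (pullbackUnitIso g).hom
    with hh'
  have h1 : (Scheme.Modules.pullback g).map h ≫ (pullbackUnitIso g).hom =
      (pullbackUnitIso g).hom ≫ h' := by simp [hh']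
  have h2 := congrArg ((Scheme.Modules.pullbackPushforwardAdjunction g).homEquiv _ _) h1
  rw [Adjunction.homEquiv_naturality_left, Adjunction.homEquiv_naturality_right,
    pullbackUnitIso, (exists_pullbackUnitIso g).choose_spec] at h2
  have h3 := congr(($h2).app ⊤ (unitSection 1))
  change (unitToPushforward g).app ⊤ (unitSection (h.app ⊤ (unitSection 1))) =
    h'.app ⊤ ((unitToPushforward g).app ⊤ (unitSection 1)) at h3
  refine Eq.trans ?_ (h3.symm.trans (unitToPushforward_app g ⊤ _))
  rw [unitToPushforward_app, map_one]
  rfl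

/-- The pullback of a trivialization. -/
def Trivialization.pullback (T : Trivialization M r) (g : X ⟶ Y) :
    Trivialization ((Scheme.Modules.pullback g).obj M) r where
  ι j := (pullbackUnitIso g).inv ≫ (Scheme.Modules.pullback g).map (T.ι j)
  π j := (Scheme.Modules.pullback g).map (T.π j) ≫ (pullbackUnitIso g).hom
  ι_π i j := by
    have h : (Scheme.Modules.pullback g).map (T.ι i) ≫ (Scheme.Modules.pullback g).map (T.π j) =
        if i = j then 𝟙 _ else 0 := by
      rw [← Functor.map_comp, T.ι_π]
      split_ifs <;> simp
    rw [Category.assoc, reassoc_of% h]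
    split_ifs <;> simp
  sum_π_ι := by
    -- The biproduct identities are equations between sums of composites, which the additive functor
    -- `pullback g` preserves.
    have := congr((Scheme.Modules.pullback g).map $(T.sum_π_ι))
    rw [Functor.map_sum, CategoryTheory.Functor.map_id] at this
    simpa using this

/-- The matrix of a morphism with respect to trivializations. -/
def Trivialization.matrix (T : Trivialization M r) (T' : Trivialization N r) (φ : M ⟶ N) :
    Matrix (Fin r) (Fin r) Γ(Y, ⊤) :=
  Matrix.of fun i j => (T.ι j ≫ φ ≫ T'.π i).app ⊤ (unitSection 1)

lemma Trivialization.matrix_pullback (T : Trivialization M r) (T' : Trivialization N r)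
    (φ : M ⟶ N) (g : X ⟶ Y) :
    (T.pullback g).matrix (T'.pullback g) ((Scheme.Modules.pullback g).map φ) =
      (T.matrix T' φ).map (g.app ⊤) := by
  ext i j
  refine Eq.trans ?_ (pullbackUnitIso_conj_app g (T.ι j ≫ φ ≫ T'.π i))
  simp only [Trivialization.matrix, Trivialization.pullback, Functor.map_comp, Category.assoc]
  rfl

/-- With equal ranks the matrix is square, so surjectivity means that the determinant is a unit. -/
lemma Trivialization.surjective_iff (T : Trivialization M r) (T' : Trivialization N r)
    (φ : M ⟶ N) (x : Y) :
    Function.Surjective (stalkMap φ x) ↔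
      IsUnit (Y.presheaf.germ ⊤ x (Opens.mem_top x) (T.matrix T' φ).det) := by
  let b := T.isFrame.basis x (Opens.mem_top x)
  let b' := T'.isFrame.basis x (Opens.mem_top x)
  have hmat : LinearMap.toMatrix b b' (stalkLin φ x) =
      (T.matrix T' φ).map (Y.presheaf.germ ⊤ x (Opens.mem_top x)) := by
    ext i j
    have h1 : stalkLin φ x (b j) =
        ∑ i, Y.presheaf.germ ⊤ x (Opens.mem_top x) (T.matrix T' φ i j) • b' i := by
      rw [IsFrame.basis_apply, stalkLin_apply, stalkMap_germ]
      simp only [b', IsFrame.basis_apply, ← germ_smul]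
      rw [← map_sum]
      congr 1
      have h2 := congr(($(T'.sum_π_ι)).app ⊤ (φ.app ⊤ ((T.ι j).app ⊤ (unitSection 1))))
      rw [hom_app_sum] at h2
      refine h2.symm.trans (Finset.sum_congr rfl fun i _ => ?_)
      refine (unit_hom_app (T'.ι i) _).trans ?_
      rw [show (homOfLE (le_top : (⊤ : Y.Opens) ≤ ⊤)).op = 𝟙 _ from rfl]
      rw [CategoryTheory.Functor.map_id]
      rfl
    rw [LinearMap.toMatrix_apply, h1, b'.repr_sum_self]
    rfl
  have h3 : Function.Surjective (stalkMap φ x) ↔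
      Function.Surjective (LinearMap.toMatrix b b' (stalkLin φ x)).mulVec := by
    have h4 : (LinearMap.toMatrix b b' (stalkLin φ x)).mulVec ∘ b.equivFun =
        b'.equivFun ∘ stalkMap φ x := by
      funext m
      exact LinearMap.toMatrix_mulVec_repr b b' (stalkLin φ x) m
    rw [← b.equivFun.surjective.of_comp_iff, h4, ← b'.equivFun.toEquiv.comp_surjective]
    rfl
  rw [h3, Matrix.mulVec_surjective_iff_isUnit, Matrix.isUnit_iff_isUnit_det, hmat]
  have h5 := RingHom.map_det (Y.presheaf.germ ⊤ x (Opens.mem_top x)).hom (T.matrix T' φ)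
  rw [← RingHom.mapMatrix_apply]
  exact iff_of_eq (congrArg IsUnit h5.symm)

/-- The determinant pulls back along `g`, and the local homomorphism `g.stalkMap x` both preserves
and reflects units. -/
lemma Trivialization.surjective_pullback_iff (T : Trivialization M r) (T' : Trivialization N r)
    (φ : M ⟶ N) (g : X ⟶ Y) (x : X) :
    Function.Surjective (stalkMap ((Scheme.Modules.pullback g).map φ) x) ↔
      Function.Surjective (stalkMap φ (g x)) := by
  rw [(T.pullback g).surjective_iff (T'.pullback g), T.surjective_iff T', T.matrix_pullback,
    ← isUnit_map_iff (g.stalkMap x).hom]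
  have h5 := RingHom.map_det (g.app ⊤).hom (T.matrix T' φ)
  have h6 := Scheme.Hom.germ_stalkMap_apply g ⊤ x (Opens.mem_top x) (T.matrix T' φ).det
  refine iff_of_eq (congrArg IsUnit ?_)
  refine Eq.trans ?_ h6.symm
  exact congrArg (X.presheaf.germ ⊤ x (Opens.mem_top x)) h5.symm

lemma surjective_stalkMap_iff_of_iso {M' N' : Y.Modules} (φ : M ⟶ N) (φ' : M' ⟶ N')
    (e : M ≅ M') (e' : N ≅ N') (h : e.hom ≫ φ' = φ ≫ e'.hom) (x : Y) :
    Function.Surjective (stalkMap φ x) ↔ Function.Surjective (stalkMap φ' x) := by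
  have hs {A B : Y.Modules} (i : A ≅ B) : Function.Bijective (stalkMap i.hom x) :=
    ConcreteCategory.bijective_of_isIso ((stalkFun x).map i.hom)
  have h1 : stalkMap φ' x ∘ stalkMap e.hom x = stalkMap e'.hom x ∘ stalkMap φ x := by
    funext m
    simp only [Function.comp_apply, ← stalkMap_comp_apply, h]
  have h2 : Function.Surjective (stalkMap φ' x) ↔
      Function.Surjective (stalkMap φ' x ∘ stalkMap e.hom x) :=
    ((hs e).surjective.of_comp_iff _).symm
  rw [h2, h1]
  exact ((Equiv.ofBijective _ (hs e')).comp_surjective _).symm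

lemma surjective_stalkMap_iff_of_natIso {F G : Y.Modules ⥤ X.Modules} (e : F ≅ G) (φ : M ⟶ N)
    (x : X) :
    Function.Surjective (stalkMap (F.map φ) x) ↔ Function.Surjective (stalkMap (G.map φ) x) :=
  surjective_stalkMap_iff_of_iso _ _ (e.app M) (e.app N) (e.hom.naturality φ).symm x

lemma surjective_restrict_iff (φ : M ⟶ N) (j : X ⟶ Y) [IsOpenImmersion j] (x : X) :
    Function.Surjective (stalkMap ((Scheme.Modules.restrictFunctor j).map φ) x) ↔
      Function.Surjective (stalkMap φ (j x)) := by
  let e := Scheme.Modules.restrictStalkNatIso j x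
  have hs (A : Y.Modules) : Function.Bijective (e.hom.app A) :=
    ConcreteCategory.bijective_of_isIso (e.hom.app A)
  have h1 : stalkMap φ (j x) ∘ e.hom.app M = e.hom.app N ∘
      stalkMap ((Scheme.Modules.restrictFunctor j).map φ) x := by
    funext m
    exact ConcreteCategory.congr_hom (e.hom.naturality φ).symm m
  have h2 : Function.Surjective (stalkMap φ (j x)) ↔
      Function.Surjective (stalkMap φ (j x) ∘ e.hom.app M) :=
    ((hs M).surjective.of_comp_iff _).symm
  rw [h2, h1]
  exact ((Equiv.ofBijective _ (hs N)).comp_surjective _).symm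

lemma surjective_pullback_iff_of_isOpenImmersion (φ : M ⟶ N) (j : X ⟶ Y) [IsOpenImmersion j]
    (x : X) :
    Function.Surjective (stalkMap ((Scheme.Modules.pullback j).map φ) x) ↔
      Function.Surjective (stalkMap φ (j x)) := by
  rw [← surjective_restrict_iff]
  exact surjective_stalkMap_iff_of_natIso (Scheme.Modules.restrictFunctorIsoPullback j).symm φ x

lemma surjective_pullback_comp_iff (φ : M ⟶ N) (f : Z ⟶ X) (g : X ⟶ Y) (z : Z) :
    Function.Surjective (stalkMap ((Scheme.Modules.pullback (f ≫ g)).map φ) z) ↔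
      Function.Surjective (stalkMap ((Scheme.Modules.pullback f).map
        ((Scheme.Modules.pullback g).map φ)) z) :=
  surjective_stalkMap_iff_of_natIso (Scheme.Modules.pullbackComp f g).symm φ z

lemma exists_trivialization_pullback (hM : IsLocallyFreeOfRank M r)
    (hN : IsLocallyFreeOfRank N r) (y : Y) :
    ∃ (W : Y.Opens), y ∈ W ∧
      Nonempty (Trivialization ((Scheme.Modules.pullback W.ι).obj M) r) ∧
      Nonempty (Trivialization ((Scheme.Modules.pullback W.ι).obj N) r) := by
  obtain ⟨U, hU, ⟨i⟩⟩ := hM y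
  obtain ⟨V, hV, ⟨j⟩⟩ := hN y
  have aux {A : Y.Modules} {V W : Y.Opens} (h : W ≤ V)
      (T : Trivialization (A.restrict V.ι) r) :
      Nonempty (Trivialization ((Scheme.Modules.pullback W.ι).obj A) r) := by
    have T' := (T.ofIso ((Scheme.Modules.restrictFunctorIsoPullback V.ι).symm.app A)).pullback
      (Y.homOfLE h)
    rw [← Y.homOfLE_ι h]
    exact ⟨T'.ofIso ((Scheme.Modules.pullbackComp _ _).symm.app A)⟩
  exact ⟨U ⊓ V, Opens.mem_inf.2 ⟨hU, hV⟩,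
    aux inf_le_left ((Trivialization.free _ r).ofIso i),
    aux inf_le_right ((Trivialization.free _ r).ofIso j)⟩

/-- A morphism between locally free modules of the same rank is surjective at the image of a point
if and only if its pullback is surjective at that point. -/
lemma surjective_pullback_iff (hM : IsLocallyFreeOfRank M r)
    (hN : IsLocallyFreeOfRank N r) (φ : M ⟶ N) (g : X ⟶ Y) (x : X) :
    Function.Surjective (stalkMap ((Scheme.Modules.pullback g).map φ) x) ↔
      Function.Surjective (stalkMap φ (g x)) := by
  obtain ⟨W, hW, ⟨T⟩, ⟨T'⟩⟩ := exists_trivialization_pullback hM hN (g x)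
  let x' : (g ⁻¹ᵁ W).toScheme := ⟨x, hW⟩
  -- Restricting to `g ⁻¹ᵁ W` and then applying `g` equals applying `g ∣_ W` and then including `W`;
  -- the second route only meets trivialized sheaves.
  have h1 := surjective_pullback_iff_of_isOpenImmersion ((Scheme.Modules.pullback g).map φ)
    (g ⁻¹ᵁ W).ι x'
  have h2 := surjective_pullback_comp_iff φ (g ⁻¹ᵁ W).ι g x'
  have h3 := surjective_pullback_comp_iff φ (g ∣_ W) W.ι x'
  have h4 := T.surjective_pullback_iff T' ((Scheme.Modules.pullback W.ι).map φ) (g ∣_ W) x'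
  have h5 := surjective_pullback_iff_of_isOpenImmersion φ W.ι ((g ∣_ W) x')
  have h6 : W.ι ((g ∣_ W) x') = g x := by
    rw [← Scheme.Hom.comp_apply, morphismRestrict_ι]; rfl
  rw [morphismRestrict_ι] at h3
  rw [h6] at h5
  exact h1.symm.trans (h2.symm.trans (h3.trans (h4.trans h5)))

end ModulesAux

/-! ### Étale algebras over polynomial rings and finiteness on affine curves. -/

namespace CurveAlgebra

open scoped TensorProduct

/-- An algebra which is étale over a domain is reduced. -/
lemma isReduced_of_etale {P B : Type*} [CommRing P] [IsDomain P] [CommRing B] [Algebra P B]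
    [Algebra.Etale P B] : IsReduced B := by
  -- By flatness `B` embeds into its base change to the fraction field, which is unramified over a
  -- field and so reduced.
  have hinj : Function.Injective (Algebra.TensorProduct.includeRight :
      B →ₐ[P] FractionRing P ⊗[P] B) :=
    Algebra.TensorProduct.includeRight_injective (IsFractionRing.injective P (FractionRing P))
  have : IsReduced (FractionRing P ⊗[P] B) :=
    Algebra.FormallyUnramified.isReduced_of_field (FractionRing P) _
  exact isReduced_of_injective (Algebra.TensorProduct.includeRight :
      B →ₐ[P] FractionRing P ⊗[P] B) hinj

lemma isReduced_of_isStandardSmooth {K B : Type*} [Field K] [CommRing B] {f : K →+* B} {n : ℕ}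
    (hf : f.IsStandardSmoothOfRelativeDimension n) : IsReduced B := by
  obtain ⟨g, -, hg⟩ := hf.exists_etale_mvPolynomial
  algebraize [g]
  exact isReduced_of_etale (P := MvPolynomial (Fin n) K)

/-- A nonzero element of `J` is algebraic over `K[t]`, so `J` meets `K[t]` in a nonzero ideal `I`.
Then `K[t]/I` is finite over `K`, and the quasi-finite algebra `B/J` over this Artinian ring is
finite. -/
lemma finite_quotient_of_etale {K B : Type*} [Field K] [CommRing B] [IsDomain B] [Algebra K B]
    [Algebra (Polynomial K) B] [IsScalarTower K (Polynomial K) B] [Algebra.Etale (Polynomial K) B]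
    {J : Ideal B} (hJ : J ≠ ⊥) : Module.Finite K (B ⧸ J) := by
  obtain ⟨x, hxJ, hx0⟩ := Submodule.exists_mem_ne_zero_of_ne_bot hJ
  have halg : IsAlgebraic (Polynomial K) x := by
    have hinj : Function.Injective (Algebra.TensorProduct.includeRight :
        B →ₐ[Polynomial K] FractionRing (Polynomial K) ⊗[Polynomial K] B) :=
      Algebra.TensorProduct.includeRight_injective
        (IsFractionRing.injective (Polynomial K) (FractionRing (Polynomial K)))
    rw [← isAlgebraic_algHom_iff _ hinj]
    have : Module.Finite (FractionRing (Polynomial K))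
        (FractionRing (Polynomial K) ⊗[Polynomial K] B) :=
      Algebra.FormallyUnramified.finite_of_free _ _
    rw [IsFractionRing.isAlgebraic_iff (Polynomial K) (FractionRing (Polynomial K))]
    exact Algebra.IsAlgebraic.isAlgebraic _
  have hI : J.comap (algebraMap (Polynomial K) B) ≠ ⊥ :=
    Ideal.comap_ne_bot_of_algebraic_mem hx0 hxJ halg
  set I := J.comap (algebraMap (Polynomial K) B) with hIdef
  have hfin : Module.Finite K (Polynomial K ⧸ I) := by
    obtain ⟨p, hpI, hp0⟩ := Submodule.exists_mem_ne_zero_of_ne_bot hI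
    have h1 : Module.Finite K (Polynomial K ⧸ Ideal.span {p}) :=
      Module.Finite.of_basis (AdjoinRoot.powerBasis hp0).basis
    have hle : Ideal.span {p} ≤ I := by rwa [Ideal.span_singleton_le_iff_mem]
    exact Module.Finite.of_surjective (M := Polynomial K ⧸ Ideal.span {p})
      (Ideal.Quotient.factorₐ K hle).toLinearMap
      (Ideal.Quotient.factor_surjective hle)
  have : IsArtinianRing (Polynomial K ⧸ I) := IsArtinianRing.of_finite K _
  have : Algebra.QuasiFinite (Polynomial K) (B ⧸ J) := inferInstance
  have : IsScalarTower (Polynomial K) (Polynomial K ⧸ I) (B ⧸ J) := inferInstance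
  have : Algebra.QuasiFinite (Polynomial K ⧸ I) (B ⧸ J) :=
    .of_restrictScalars (Polynomial K) _ _
  have : Module.Finite (Polynomial K ⧸ I) (B ⧸ J) := Module.Finite.of_quasiFinite
  have : IsScalarTower K (Polynomial K ⧸ I) (B ⧸ J) := .of_algebraMap_eq
      (R := K) (S := Polynomial K ⧸ I) (A := B ⧸ J) fun a => by
    rw [IsScalarTower.algebraMap_apply K (Polynomial K) (B ⧸ J),
      IsScalarTower.algebraMap_apply K (Polynomial K) (Polynomial K ⧸ I),
      ← IsScalarTower.algebraMap_apply (Polynomial K) (Polynomial K ⧸ I) (B ⧸ J)]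
  exact Module.Finite.trans (Polynomial K ⧸ I) _

lemma exists_etale_polynomial {K B : Type u} [Field K] [CommRing B]
    [Algebra K B] (hf : (algebraMap K B).IsStandardSmoothOfRelativeDimension 1) :
    ∃ g : Polynomial K →+* B, g.comp Polynomial.C = algebraMap K B ∧ g.Etale := by
  obtain ⟨g, hg, hg'⟩ := hf.exists_etale_mvPolynomial
  let e := (MvPolynomial.uniqueAlgEquiv K (Fin 1)).symm
  refine ⟨g.comp e.toRingEquiv.toRingHom, ?_, ?_⟩
  · rw [← hg]
    ext a
    exact congrArg g (e.commutes a)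
  · exact RingHom.Etale.respectsIso.2 g e.toRingEquiv hg'

/-- A proper closed subscheme of an affine curve is finite. -/
lemma finite_quotient_of_isStandardSmooth {K B : Type u} [Field K] [CommRing B] [IsDomain B]
    [Algebra K B] (hf : (algebraMap K B).IsStandardSmoothOfRelativeDimension 1)
    {J : Ideal B} (hJ : J ≠ ⊥) : Module.Finite K (B ⧸ J) := by
  obtain ⟨g, hg, hg'⟩ := exists_etale_polynomial hf
  algebraize [g]
  have : IsScalarTower K (Polynomial K) B := .of_algebraMap_eq' hg.symm
  exact finite_quotient_of_etale hJ

/-- A bijection which preserves membership in a finite set, except possibly at one point, maps this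
set to itself. -/
lemma mapsTo_of_subsingleton {α : Type*} {σ : α → α} (hσ : Function.Bijective σ) {S T : Set α}
    (hS : S.Finite) (hT : T.Subsingleton) (h : ∀ x ∉ T, x ∈ S ↔ σ x ∈ S) : Set.MapsTo σ S S := by
  intro x hx
  by_contra hσx
  have hxT : x ∈ T := by
    by_contra hxT
    exact hσx ((h x hxT).1 hx)
  -- The exceptional point is `x` itself, so `σ ⁻¹' S` would be `S` with `x` removed at least,
  -- although a bijection preserves cardinality.
  have hsub : σ ⁻¹' S ⊂ S := by
    refine ⟨fun y hy => ?_, fun hle => hσx (hle hx)⟩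
    by_cases hyT : y ∈ T
    · exact hT hyT hxT ▸ hx
    · exact (h y hyT).2 hy
  have hlt := Set.ncard_lt_ncard hsub hS
  rw [Set.ncard_preimage_of_injective_subset_range hσ.1 (by simp [hσ.2.range_eq])] at hlt
  exact hlt.false

/-! ### Frobenius-semilinear maps and the partial Frobenius on `A ⊗ L`. -/

section Frobenius

variable {k L : Type u} [Field k] [Fintype k] [Field L] [Algebra k L]

/-- The polynomial `X^q - X` has at most `q` roots, and the elements of `k` already supply them. -/
lemma mem_range_algebraMap_of_pow_card_eq {x : L} (hx : x ^ Fintype.card k = x) :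
    x ∈ (algebraMap k L).range := by
  classical
  have hq := Fintype.one_lt_card (α := k)
  have h0 : (Polynomial.X ^ Fintype.card k - Polynomial.X : Polynomial L) ≠ 0 :=
    FiniteField.X_pow_card_sub_X_ne_zero L hq
  by_contra hxk
  have hinj := (algebraMap k L).injective
  have hx' : x ∉ Finset.univ.image (algebraMap k L) := by
    simpa using hxk
  have h := Polynomial.card_le_degree_of_subset_roots
    (p := (Polynomial.X ^ Fintype.card k - Polynomial.X : Polynomial L))
    (Z := insert x (Finset.univ.image (algebraMap k L))) (by
      intro y hy
      rw [Finset.mem_val, Finset.mem_insert] at hy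
      rw [Polynomial.mem_roots h0]
      obtain rfl | hy := hy
      · simp [hx]
      · obtain ⟨a, -, rfl⟩ := Finset.mem_image.1 hy
        simp [← map_pow, FiniteField.pow_card])
  rw [Finset.card_insert_of_notMem hx', Finset.card_image_of_injective _ hinj,
    FiniteField.X_pow_card_sub_X_natDegree_eq L hq, Finset.card_univ] at h
  omega

variable {V : Type*} [AddCommGroup V] [Module k V] [Module L V] [IsScalarTower k L V]

/-- Vectors fixed by a Frobenius-semilinear map which are independent over the finite base field
are independent. -/
lemma linearIndepOn_of_frobenius_fixed (φ : V →+ V)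
    (hφ : ∀ (l : L) (v : V), φ (l • v) = l ^ Fintype.card k • φ v)
    {ι : Type*} (v : ι → V) (hv : ∀ i, φ (v i) = v i) (s : Finset ι)
    (hs : LinearIndepOn k v (s : Set ι)) : LinearIndepOn L v (s : Set ι) := by
  classical
  induction s using Finset.induction_on with
  | empty => simp
  | insert a s ha ih =>
    rw [Finset.coe_insert] at hs ⊢
    have ha' : a ∉ (s : Set ι) := by simpa using ha
    rw [linearIndepOn_insert ha'] at hs ⊢
    refine ⟨ih hs.1, fun hmem => hs.2 ?_⟩
    have hind := ih hs.1
    rw [Submodule.mem_span_image_finset_iff_exists_fun] at hmem ⊢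
    obtain ⟨c, hc⟩ := hmem
    -- Applying `φ` to the relation raises its coefficients to the `q`-th power; uniqueness gives `c
    -- i ^ q = c i`, so the relation is defined over `k`.
    have hc' : ∑ i : s, c i ^ Fintype.card k • v i = v a := by
      rw [← hv a, ← hc, map_sum]
      exact Finset.sum_congr rfl fun i _ => by rw [hφ, hv]
    have hfix (i : s) : c i ^ Fintype.card k = c i := by
      rw [← sub_eq_zero]
      refine Fintype.linearIndependent_iff.1 hind (fun i => c i ^ Fintype.card k - c i) ?_ i
      simp only [sub_smul, Finset.sum_sub_distrib]
      exact sub_eq_zero.2 (hc'.trans hc.symm)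
    choose b hb using fun i => mem_range_algebraMap_of_pow_card_eq (hfix i)
    refine ⟨b, ?_⟩
    rw [← hc]
    refine Finset.sum_congr rfl fun i _ => ?_
    rw [← hb i, algebraMap_smul]

lemma finite_of_frobenius_fixed [Module.Finite L V] (φ : V →+ V)
    (hφ : ∀ (l : L) (v : V), φ (l • v) = l ^ Fintype.card k • φ v)
    (W : Submodule k V) (hW : ∀ w ∈ W, φ w = w) : Module.Finite k W := by
  let b := Module.Free.chooseBasis k W
  have hb : LinearIndependent k (fun i => (b i : V)) :=
    b.linearIndependent.map' W.subtype W.ker_subtype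
  have hL : LinearIndependent L (fun i => (b i : V)) := by
    rw [← linearIndepOn_univ_iff, linearIndepOn_iff_linearIndepOn_finset]
    intro t _
    exact linearIndepOn_of_frobenius_fixed φ hφ _ (fun i => hW _ (b i).2) t
      (hb.linearIndepOn _)
  have := hL.finite
  exact Module.Finite.of_basis b

variable {A B : CommRingCat.{u}} {f : CommRingCat.of k ⟶ A} {iA : A ⟶ B}
  {iL : CommRingCat.of L ⟶ B}

/-- The Frobenius `ρ` of the factor `A` complements `φ`, the Frobenius of the factor `L`: both
composites are the absolute `q`-Frobenius of `B`, which fixes every prime. -/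
lemma bijective_comap_of_isPushout
    (h : IsPushout f (CommRingCat.ofHom (algebraMap k L)) iA iL) (φ : B ⟶ B)
    (hA : iA ≫ φ = iA)
    (hL : iL ≫ φ = CommRingCat.ofHom (FiniteField.frobeniusAlgHom k L).toRingHom ≫ iL) :
    Function.Bijective (PrimeSpectrum.comap φ.hom) := by
  algebraize [f.hom, (f ≫ iA).hom]
  let FA : A ⟶ A := CommRingCat.ofHom (FiniteField.frobeniusAlgHom k A).toRingHom
  let FB : B ⟶ B := CommRingCat.ofHom (FiniteField.frobeniusAlgHom k B).toRingHom
  have hfA : f ≫ FA = f := by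
    ext a
    exact (FiniteField.frobeniusAlgHom k A).commutes a
  let ρ : B ⟶ B := h.desc (FA ≫ iA) iL (by rw [reassoc_of% hfA, h.w])
  have hρA : iA ≫ ρ = FA ≫ iA := h.inl_desc _ _ _
  have hρL : iL ≫ ρ = iL := h.inr_desc _ _ _
  have hFA : FA ≫ iA = iA ≫ FB := by
    ext a
    exact map_pow iA.hom a _
  have hFL : CommRingCat.ofHom (FiniteField.frobeniusAlgHom k L).toRingHom ≫ iL = iL ≫ FB := by
    ext a
    exact map_pow iL.hom a _
  have h1 : φ ≫ ρ = FB := by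
    refine h.hom_ext ?_ ?_
    · rw [reassoc_of% hA, hρA, hFA]
    · rw [reassoc_of% hL, hρL, hFL]
  have h2 : ρ ≫ φ = FB := by
    refine h.hom_ext ?_ ?_
    · rw [reassoc_of% hρA, hA, hFA]
    · rw [reassoc_of% hρL, hL, hFL]
  have hFB (P : PrimeSpectrum B) : PrimeSpectrum.comap FB.hom P = P := by
    ext b
    change b ^ Fintype.card k ∈ P.asIdeal ↔ b ∈ P.asIdeal
    exact P.isPrime.pow_mem_iff_mem _ Fintype.card_pos
  refine Function.bijective_iff_has_inverse.2 ⟨PrimeSpectrum.comap ρ.hom, fun P => ?_, fun P => ?_⟩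
  · rw [← PrimeSpectrum.comap_comp_apply, ← CommRingCat.hom_comp, h2, hFB]
  · rw [← PrimeSpectrum.comap_comp_apply, ← CommRingCat.hom_comp, h1, hFB]

/-- A proper closed subset of the affine curve `Spec (A ⊗ L)` which is stable under the Frobenius
of `L`, except possibly at one point, lies over finitely many closed points of `Spec A`. -/
lemma finite_and_isMaximal_comap [IsDomain B]
    (h : IsPushout f (CommRingCat.ofHom (algebraMap k L)) iA iL)
    (hsm : iL.hom.IsStandardSmoothOfRelativeDimension 1) (φ : B ⟶ B) (hA : iA ≫ φ = iA)
    (hL : iL ≫ φ = CommRingCat.ofHom (FiniteField.frobeniusAlgHom k L).toRingHom ≫ iL)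
    {J : Ideal B} (hJ : J ≠ ⊥) {S T : Set (PrimeSpectrum B)} (hS : ∀ P ∈ S, J ≤ P.asIdeal)
    (hT : T.Subsingleton) (hST : ∀ P ∉ T, P ∈ S ↔ PrimeSpectrum.comap φ.hom P ∈ S) :
    S.Finite ∧ ∀ P ∈ S, (P.asIdeal.comap iA.hom).IsMaximal := by
  algebraize [iL.hom]
  have hfinJ : Module.Finite L (B ⧸ J) := finite_quotient_of_isStandardSmooth hsm hJ
  have hart : IsArtinianRing (B ⧸ J) := IsArtinianRing.of_finite L _
  have hSfin : S.Finite := by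
    -- The primes containing `J` come from the Artinian ring `B ⧸ J`, which has only finitely many.
    refine (Set.toFinite (PrimeSpectrum.comap (Ideal.Quotient.mk J) '' Set.univ)).subset ?_
    intro P hP
    rw [Set.image_univ, range_comap_of_surjective _ _ Ideal.Quotient.mk_surjective]
    simpa using hS P hP
  have hmaps := mapsTo_of_subsingleton (bijective_comap_of_isPushout h φ hA hL) hSfin hT hST
  refine ⟨hSfin, fun P hP => ?_⟩
  -- The ideal `J` need not be stable under `φ`, but `I` is, because `comap φ` maps `S` into itself.
  -- So `φ` descends to `B ⧸ I`.
  let I : Ideal B := ⨅ P ∈ S, P.asIdeal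
  have hIP : ∀ P ∈ S, I ≤ P.asIdeal := fun P hP => iInf₂_le P hP
  have hJI : J ≤ I := le_iInf₂ hS
  have hI : I ≠ ⊥ := fun h0 => hJ (le_bot_iff.1 (h0 ▸ hJI))
  have hfinI : Module.Finite L (B ⧸ I) := finite_quotient_of_isStandardSmooth hsm hI
  have hIφ : I ≤ I.comap φ.hom := fun b hb => by
    rw [Ideal.mem_comap]
    simp only [I, Ideal.mem_iInf]
    exact fun Q hQ => hIP _ (hmaps hQ) hb
  let ψ : B ⧸ I →+* B ⧸ I := Ideal.quotientMap I φ.hom hIφ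
  let : Algebra k A := f.hom.toAlgebra
  let : Algebra k B := (f ≫ iA).hom.toAlgebra
  have : IsScalarTower k L B := .of_algebraMap_eq fun a =>
    congrArg (fun g : CommRingCat.of k ⟶ B => g.hom a) h.w
  let α : A →ₐ[k] B ⧸ I :=
    { (Ideal.Quotient.mk I).comp iA.hom with commutes' := fun _ => rfl }
  -- Since `φ` is the identity on `A`, the image of `A` consists of fixed vectors of the semilinear
  -- map `ψ`.
  have hfin : Module.Finite k (LinearMap.range α.toLinearMap) := by
    refine finite_of_frobenius_fixed (L := L) ψ.toAddMonoidHom ?_ _ ?_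
    · intro l v
      obtain ⟨b, rfl⟩ := Ideal.Quotient.mk_surjective v
      have hl : φ.hom (iL.hom l) = iL.hom l ^ Fintype.card k :=
        (congrArg (fun g : CommRingCat.of L ⟶ B => g.hom l) hL).trans (map_pow iL.hom l _)
      change Ideal.Quotient.mk I (φ.hom (l • b)) =
        l ^ Fintype.card k • Ideal.Quotient.mk I (φ.hom b)
      rw [Algebra.smul_def, Algebra.smul_def, map_mul, map_mul]
      congr 1
      change Ideal.Quotient.mk I (φ.hom (iL.hom l)) = Ideal.Quotient.mk I (iL.hom _)
      rw [hl]
      exact congrArg (Ideal.Quotient.mk I) (map_pow iL.hom l _).symm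
    · rintro _ ⟨a, rfl⟩
      change Ideal.Quotient.mk I (φ.hom (iA.hom a)) = Ideal.Quotient.mk I (iA.hom a)
      exact congrArg (fun g : A ⟶ B => Ideal.Quotient.mk I (g.hom a)) hA
  have hker : LinearMap.ker α.toLinearMap ≤
      (Submodule.restrictScalars k (P.asIdeal.comap iA.hom)) := by
    intro a ha
    exact hIP P hP (Ideal.Quotient.eq_zero_iff_mem.1 ha)
  have : Module.Finite k (A ⧸ P.asIdeal.comap iA.hom) := by
    have := Module.Finite.equiv α.toLinearMap.quotKerEquivRange.symm
    refine Module.Finite.of_surjective (M := A ⧸ LinearMap.ker α.toLinearMap)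
      (Submodule.liftQ _ (Ideal.Quotient.mkₐ k (P.asIdeal.comap iA.hom)).toLinearMap ?_) ?_
    · intro a ha
      exact Ideal.Quotient.eq_zero_iff_mem.2 (hker ha)
    · intro y
      obtain ⟨a, rfl⟩ := Ideal.Quotient.mk_surjective y
      exact ⟨Submodule.Quotient.mk a, rfl⟩
  have : IsArtinianRing (A ⧸ P.asIdeal.comap iA.hom) := IsArtinianRing.of_finite k _
  exact Ideal.Quotient.maximal_of_isField _ (IsArtinianRing.isField_of_isDomain _)

end Frobenius

/-! ### Determinants of periodic systems and comparison of slopes. -/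

/-- If the image of a map between free modules of rank `r` is `J` times the target, then its
determinant generates `J ^ r`. -/
lemma span_det_toMatrix {R M M' : Type*} [CommRing R] [AddCommGroup M] [Module R M]
    [AddCommGroup M'] [Module R M'] {r : ℕ} (b : Module.Basis (Fin r) R M)
    (b' : Module.Basis (Fin r) R M') (A : M →ₗ[R] M') (J : Ideal R)
    (h : LinearMap.range A = J • (⊤ : Submodule R M')) :
    Ideal.span {(LinearMap.toMatrix b b' A).det} = J ^ r := by
  refine le_antisymm ?_ ?_
  · rw [Ideal.span_singleton_le_iff_mem, Matrix.det_apply]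
    refine Ideal.sum_mem _ fun σ _ => ?_
    refine Submodule.smul_of_tower_mem _ _ ?_
    have hentry (i j : Fin r) : LinearMap.toMatrix b b' A i j ∈ J := by
      rw [LinearMap.toMatrix_apply]
      have hmem : A (b j) ∈ J • (⊤ : Submodule R M') := h ▸ LinearMap.mem_range_self A (b j)
      refine Submodule.smul_induction_on (p := fun x => b'.repr x i ∈ J) hmem ?_ ?_
      · intro a ha x _
        rw [map_smul, Finsupp.smul_apply, smul_eq_mul]
        exact J.mul_mem_right _ ha
      · intro x y hx hy
        rw [map_add, Finsupp.add_apply]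
        exact J.add_mem hx hy
    have := Ideal.prod_mem_prod (s := Finset.univ) (I := fun _ : Fin r => J)
      (x := fun i => LinearMap.toMatrix b b' A (σ i) i) (fun i _ => hentry _ _)
    simpa using this
  · rw [Submodule.pow_eq_span_pow_set, Submodule.span_le]
    intro y hy
    obtain ⟨x, rfl⟩ := Set.mem_pow.1 hy
    -- Products `x 0 * ⋯ * x (r - 1)` of elements of `J` generate `J ^ r`. Lifting each `x i • b' i`
    -- through `A` factors the diagonal matrix of `x` through `A`, so `det A` divides this product.
    have hx (i : Fin r) : ∃ c, A c = (x i : R) • b' i := by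
      have : (x i : R) • b' i ∈ LinearMap.range A := by
        rw [h]
        exact Submodule.smul_mem_smul (x i).2 trivial
      exact this
    choose c hc using hx
    let C := LinearMap.toMatrix b b (b.constr ℕ c)
    have hprod : LinearMap.toMatrix b b' A * C = Matrix.diagonal fun i => (x i : R) := by
      rw [← LinearMap.toMatrix_comp]
      ext i j
      rw [LinearMap.toMatrix_apply, LinearMap.comp_apply, Module.Basis.constr_basis, hc]
      by_cases hij : i = j
      · subst hij
        simp
      · simp [hij]
    have hdet := congrArg Matrix.det hprod
    rw [Matrix.det_mul, Matrix.det_diagonal] at hdet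
    rw [SetLike.mem_coe, Ideal.mem_span_singleton]
    refine ⟨C.det, ?_⟩
    rw [hdet, List.prod_ofFn]

/-- Tracing the recursion back `n` steps puts every `δ i` in `I ^ n`; Krull's intersection theorem
concludes. The indices must run over all of `ℤ`. -/
lemma eq_zero_of_step {R : Type*} [CommRing R] [IsDomain R] [IsNoetherianRing R] {I : Ideal R}
    (hI : I ≠ ⊤) (δ : ℤ → R) (e : ℤ) (h : ∀ i, ∃ t ∈ I, δ (i + e) = t * δ i) (i : ℤ) :
    δ i = 0 := by
  have hmem (n : ℕ) : ∀ i, δ i ∈ I ^ n := by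
    induction n with
    | zero => simp
    | succ n ih =>
      intro i
      obtain ⟨t, ht, hδ⟩ := h (i - e)
      rw [sub_add_cancel] at hδ
      rw [hδ, pow_succ']
      exact Ideal.mul_mem_mul ht (ih _)
  have hbot := Ideal.iInf_pow_eq_bot_of_isDomain I hI
  rw [← Ideal.mem_bot, ← hbot, Ideal.mem_iInf]
  exact fun n => hmem n i

lemma exists_mem_mul_eq {R : Type*} [CommRing R] {I : Ideal R} {a a' : R} {s s' : ℕ}
    (ha : Ideal.span {a} = I ^ s) (ha' : Ideal.span {a'} = I ^ s') (h : s < s') :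
    ∃ t ∈ I, a' = t * a := by
  obtain ⟨n, rfl⟩ := Nat.exists_eq_add_of_lt h
  have hmem : a' ∈ Ideal.span {a} * I := by
    have : a' ∈ I ^ (s + n + 1) := ha' ▸ Ideal.mem_span_singleton_self a'
    rw [ha, ← pow_succ]
    exact Ideal.pow_le_pow_right (by omega) this
  obtain ⟨t, ht, hta⟩ := Ideal.mem_span_singleton_mul.1 hmem
  exact ⟨t, ht, by rw [← hta, mul_comm]⟩

lemma span_singleton_periodic {R : Type*} [CommRing R] {I : Ideal R} {p : ℤ → ℤ → R} {l s : ℕ}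
    (h1 : ∀ i, p i i = 1)
    (hp : ∀ i j k, i ≤ j → j ≤ k → p i k = p j k * p i j)
    (hl : ∀ i, Ideal.span {p i (i + l)} = I ^ s) (n : ℕ) (i : ℤ) :
    Ideal.span {p i (i + (l * n : ℕ))} = I ^ (s * n) := by
  induction n with
  | zero => simp [h1, Ideal.one_eq_top]
  | succ n ih =>
    rw [hp i (i + (l * n : ℕ)) _ (by omega) (by rw [mul_add]; omega),
      ← Ideal.span_singleton_mul_span_singleton, ih, mul_add, mul_add, mul_one, mul_one,
      Nat.cast_add, ← add_assoc, hl, mul_comm, pow_add]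

/-- Two periodic systems which are related by nonzero maps have the same slope. -/
lemma slope_eq {R : Type*} [CommRing R] [IsDomain R] [IsNoetherianRing R] {I : Ideal R}
    (hI : I ≠ ⊤) {p p' : ℤ → ℤ → R} {δ : ℤ → R} {l l' s s' : ℕ}
    (h1 : ∀ i, p i i = 1) (h1' : ∀ i, p' i i = 1)
    (hp : ∀ i j k, i ≤ j → j ≤ k → p i k = p j k * p i j)
    (hp' : ∀ i j k, i ≤ j → j ≤ k → p' i k = p' j k * p' i j)
    (hp0 : ∀ i j, i ≤ j → p i j ≠ 0) (hp0' : ∀ i j, i ≤ j → p' i j ≠ 0)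
    (hδ : ∀ i j, i ≤ j → δ j * p i j = p' i j * δ i)
    (hl : ∀ i, Ideal.span {p i (i + l)} = I ^ s)
    (hl' : ∀ i, Ideal.span {p' i (i + l')} = I ^ s') {i : ℤ} (hi : δ i ≠ 0) :
    s * l' = s' * l := by
  have H (i) := span_singleton_periodic h1 hp hl l' i
  have H' (i) := span_singleton_periodic h1' hp' hl' l i
  rw [mul_comm l' l] at H'
  have hle (i : ℤ) : i ≤ i + (l * l' : ℕ) := by omega
  rcases lt_trichotomy (s * l') (s' * l) with h | h | h
  · refine (hi (eq_zero_of_step hI δ (l * l' : ℕ) (fun i => ?_) i)).elim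
    -- Over the common period `l * l'` the target factor is `t` times the source factor, which then
    -- cancels and leaves `δ (i + l * l') = t * δ i`.
    obtain ⟨t, ht, hta⟩ := exists_mem_mul_eq (H i) (H' i) h
    refine ⟨t, ht, mul_right_cancel₀ (hp0 _ _ (hle i)) ?_⟩
    rw [hδ _ _ (hle i), hta]
    ring
  · exact h
  -- Now `p'` divides `p`, so the same recursion runs downwards.
  · refine (hi (eq_zero_of_step hI δ (-(l * l' : ℕ)) (fun i => ?_) i)).elim
    have hle' : i + -((l * l' : ℕ) : ℤ) ≤ i := by omega
    have hi' : i + -((l * l' : ℕ) : ℤ) + (l * l' : ℕ) = i := by omega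
    have H1 := H (i + -((l * l' : ℕ) : ℤ))
    have H2 := H' (i + -((l * l' : ℕ) : ℤ))
    rw [hi'] at H1 H2
    obtain ⟨t, ht, hta⟩ := exists_mem_mul_eq H2 H1 h
    refine ⟨t, ht, mul_left_cancel₀ (hp0' _ _ hle') ?_⟩
    rw [← hδ _ _ hle', hta]
    ring

/-! ### Affine charts of smooth schemes over a field. -/

/-- The spectrum of a nonempty affine curve is not discrete. -/
lemma not_discreteTopology_of_isStandardSmooth {K B : Type u} [Field K] [CommRing B] [Nontrivial B]
    [Algebra K B] (hf : (algebraMap K B).IsStandardSmoothOfRelativeDimension 1) :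
    ¬ DiscreteTopology (PrimeSpectrum B) := by
  intro hB
  obtain ⟨g, hg, hg'⟩ := exists_etale_polynomial hf
  algebraize [g]
  have : IsScalarTower K (Polynomial K) B := .of_algebraMap_eq' hg.symm
  have : Algebra.FiniteType K B := .trans (S := Polynomial K) inferInstance inferInstance
  -- Discreteness gives Krull dimension zero, hence finiteness over `K`; but `B` contains `K[t]`.
  have hfin : Module.Finite K B := (Module.finite_iff_krullDimLE_zero K B).2
    (PrimeSpectrum.discreteTopology_iff_finite_and_krullDimLE_zero.1 hB).2
  have hinj : Function.Injective (algebraMap (Polynomial K) B) :=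
    FaithfulSMul.algebraMap_injective _ _
  have : Module.Finite K (Polynomial K) :=
    Module.Finite.of_injective (IsScalarTower.toAlgHom K (Polynomial K) B).toLinearMap hinj
  exact Polynomial.not_finite this

/-- The map from the base field to the sections of a scheme over it. -/
def constants {K : Type u} [Field K] {Z : Scheme.{u}} (f : Z ⟶ Spec (.of K)) (V : Z.Opens) :
    CommRingCat.of K ⟶ Γ(Z, V) :=
  (Scheme.ΓSpecIso (.of K)).inv ≫ f.appLE ⊤ V le_top

lemma constants_map {K : Type u} [Field K] {Z : Scheme.{u}} (f : Z ⟶ Spec (.of K)) {V W : Z.Opens}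
    (h : W ≤ V) : constants f V ≫ Z.presheaf.map (homOfLE h).op = constants f W := by
  rw [constants, Category.assoc]
  exact congrArg ((Scheme.ΓSpecIso (.of K)).inv ≫ ·) (f.appLE_map (U := ⊤) le_top (homOfLE h).op)

/-- The base of a smooth chart is all of the one-point space `Spec K`, and standard smoothness
survives shrinking to a basic open. -/
lemma exists_isStandardSmooth {K : Type u} [Field K] {Z : Scheme.{u}} (f : Z ⟶ Spec (.of K))
    {n : ℕ} [hf : SmoothOfRelativeDimension n f] (x : Z) (U : Z.Opens) (hx : x ∈ U) :
    ∃ V : Z.Opens, IsAffineOpen V ∧ x ∈ V ∧ V ≤ U ∧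
      (constants f V).hom.IsStandardSmoothOfRelativeDimension n := by
  obtain ⟨W, hW, V, hV, hxV, hVW, hs⟩ := hf.exists_isStandardSmoothOfRelativeDimension x
  have hW' : W = ⊤ := by
    rw [eq_top_iff]
    intro y _
    rw [Subsingleton.elim y (f x)]
    exact hVW hxV
  subst hW'
  obtain ⟨a, ha, hxa⟩ := hV.exists_basicOpen_le ⟨x, hx⟩ hxV
  have hs' : (constants f V).hom.IsStandardSmoothOfRelativeDimension n :=
    RingHom.isStandardSmoothOfRelativeDimension_respectsIso.2 _
      (Scheme.ΓSpecIso (.of K)).symm.commRingCatIsoToRingEquiv hs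
  refine ⟨Z.basicOpen a, hV.basicOpen a, hxa, ha, ?_⟩
  have := hV.isLocalization_basicOpen a
  rw [← constants_map f (Z.basicOpen_le a)]
  exact (RingHom.isStandardSmoothOfRelativeDimension_stableUnderCompositionWithLocalizationAway
    n).right _ a _ hs'

lemma isReduced_of_smooth {K : Type u} [Field K] {Z : Scheme.{u}} (f : Z ⟶ Spec (.of K))
    {n : ℕ} [hf : SmoothOfRelativeDimension n f] : IsReduced Z := by
  have (x : Z) : _root_.IsReduced (Z.presheaf.stalk x) := by
    obtain ⟨V, hV, hx, -, hs⟩ := exists_isStandardSmooth f (n := n) x ⊤ trivial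
    have := isReduced_of_isStandardSmooth hs
    have := hV.isLocalization_stalk ⟨x, hx⟩
    let := (Z.presheaf.germ V x hx).hom.toAlgebra
    exact isReduced_localizationPreserves
      (hV.primeIdealOf ⟨x, hx⟩).asIdeal.primeCompl _ ‹_›
  exact isReduced_of_isReduced_stalk Z

end CurveAlgebra

/-! ### Geometry of `C` and `C_L`: integrality, the point `∞`, charts. -/

namespace PointedCurve

open CurveAlgebra

variable {k : Type u} [Field k] (X : PointedCurve k) (L : Type u) [Field L] [Algebra k L]

instance : SmoothOfRelativeDimension 1 X.str := X.smooth

instance : IsProper X.str := X.proper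

instance smooth_toSpec : SmoothOfRelativeDimension 1 (X.toSpec L) :=
  (smoothOfRelativeDimension_isStableUnderBaseChange 1).of_isPullback
    (IsPullback.of_hasPullback X.str (baseMap k L)) X.smooth

instance : IsReduced (X.CL L) := isReduced_of_smooth (X.toSpec L) (n := 1)

instance : IsIntegral (X.CL L) := isIntegral_of_irreducibleSpace_of_isReduced _

instance : IsLocallyNoetherian (X.CL L) := LocallyOfFiniteType.isLocallyNoetherian (X.toSpec L)

instance : IsLocallyNoetherian X.C := LocallyOfFiniteType.isLocallyNoetherian X.str

instance : CompactSpace X.C := QuasiCompact.compactSpace_of_compactSpace X.str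

instance : IsNoetherian X.C where

instance : JacobsonSpace X.C := LocallyOfFiniteType.jacobsonSpace X.str

/-- The closed point `∞`. -/
def inftyPt : X.C := X.infty (IsLocalRing.closedPoint k)

lemma range_infty : Set.range X.infty = {X.inftyPt} := by
  ext y
  simp only [Set.mem_range, Set.mem_singleton_iff]
  constructor
  · rintro ⟨z, rfl⟩
    rw [Subsingleton.elim z (IsLocalRing.closedPoint k)]
    rfl
  · rintro rfl
    exact ⟨_, rfl⟩

/-- A section of a separated morphism is a closed immersion. -/
lemma isClosed_inftyPt : IsClosed {X.inftyPt} := by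
  have : IsClosedImmersion (X.infty ≫ X.str) := by
    rw [X.infty_str]
    infer_instance
  have : IsClosedImmersion X.infty := IsClosedImmersion.of_comp X.infty X.str
  rw [← range_infty]
  exact X.infty.isClosedEmbedding.isClosed_range

variable {X L}

instance (c : X.Point L) : IsClosedImmersion c.graph := by
  have : IsClosedImmersion (c.graph ≫ X.toSpec L) := by
    rw [Point.graph, pullback.lift_snd]
    infer_instance
  exact IsClosedImmersion.of_comp c.graph (X.toSpec L)

lemma support_graphIdeal (c : X.Point L) :
    (c.graphIdeal.support : Set (X.CL L)) = Set.range c.graph := by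
  rw [Point.graphIdeal, Scheme.Hom.support_ker, c.graph.isClosedEmbedding.isClosed_range.closure_eq]

lemma subsingleton_support_graphIdeal (c : X.Point L) :
    (c.graphIdeal.support : Set (X.CL L)).Subsingleton := by
  rw [support_graphIdeal]
  rintro _ ⟨x, rfl⟩ _ ⟨y, rfl⟩
  rw [Subsingleton.elim x y]

lemma toC_of_mem_support {x : X.CL L} (hx : x ∈ (X.inftyPoint L).graphIdeal.support) :
    X.toC L x = X.inftyPt := by
  rw [← SetLike.mem_coe, support_graphIdeal] at hx
  obtain ⟨z, rfl⟩ := hx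
  rw [← Scheme.Hom.comp_apply, Point.graph, pullback.lift_fst]
  have : (X.inftyPoint L).hom z ∈ Set.range X.infty := ⟨baseMap k L z, rfl⟩
  rwa [range_infty] at this

variable (L) in
lemma dense_toC_genericPoint : closure {X.toC L (genericPoint (X.CL L))} = Set.univ := by
  have : Surjective (baseMap k L) := ⟨fun y => ⟨IsLocalRing.closedPoint L, Subsingleton.elim _ _⟩⟩
  have hsurj := (X.toC L).surjective
  rw [Set.eq_univ_iff_forall]
  intro y
  obtain ⟨x, rfl⟩ := hsurj y
  have hx : x ∈ closure {genericPoint (X.CL L)} := by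
    rw [genericPoint_closure]
    trivial
  simpa using image_closure_subset_closure_image (X.toC L).continuous (Set.mem_image_of_mem _ hx)

/-- Otherwise an affine chart would have finite Jacobson spectrum, which is discrete. -/
lemma not_finite_univ : ¬ (Set.univ : Set X.C).Finite := by
  intro h
  obtain ⟨V, hV, hx, -, hs⟩ := exists_isStandardSmooth X.str (n := 1) X.inftyPt ⊤ trivial
  algebraize [(constants X.str V).hom]
  have : Nonempty V := ⟨⟨_, hx⟩⟩
  have : Nontrivial Γ(X.C, V) := inferInstance
  have : Finite X.C := Set.finite_univ_iff.1 h
  have : Finite (PrimeSpectrum Γ(X.C, V)) :=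
    Finite.of_injective hV.fromSpec hV.fromSpec.isOpenEmbedding.injective
  have : Algebra.IsStandardSmooth k Γ(X.C, V) :=
    Algebra.IsStandardSmoothOfRelativeDimension.isStandardSmooth 1
  have : Algebra.FiniteType k Γ(X.C, V) := inferInstance
  have : IsJacobsonRing Γ(X.C, V) := isJacobsonRing_of_finiteType (A := k)
  have : JacobsonSpace (PrimeSpectrum Γ(X.C, V)) :=
    PrimeSpectrum.isJacobsonRing_iff_jacobsonSpace.1 inferInstance
  exact not_discreteTopology_of_isStandardSmooth (K := k) hs inferInstance

lemma toC_genericPoint_notMem {D : Set X.C} (hD : D.Finite) (hD' : IsClosed D) :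
    X.toC L (genericPoint (X.CL L)) ∉ D := by
  intro hmem
  refine X.not_finite_univ (hD.subset ?_)
  rw [← dense_toC_genericPoint L]
  exact hD'.closure_subset_iff.2 (Set.singleton_subset_iff.2 hmem)

/-- Functions on `V_L` are `Γ(C, V) ⊗ L`, the form required by `finite_and_isMaximal_comap`. -/
lemma isPushout_constants {V : X.C.Opens} (hV : IsAffineOpen V) :
    IsPushout (constants X.str V) (CommRingCat.ofHom (algebraMap k L)) ((X.toC L).app V)
      (constants (X.toSpec L) (X.toC L ⁻¹ᵁ V)) := by
  have h := (isIso_pushoutSection_iff (IsPullback.of_hasPullback X.str (baseMap k L))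
    (US := ⊤) (UT := ⊤) (UX := V) (UY := X.toC L ⁻¹ᵁ V) le_top le_top (by simp)).1
    (isIso_pushoutSection_of_isAffineOpen _ _ _ _ (isAffineOpen_top _) (isAffineOpen_top _) hV)
  refine h.of_iso (Scheme.ΓSpecIso (.of k)) (Iso.refl _) (Scheme.ΓSpecIso (.of L)) (Iso.refl _)
    ?_ ?_ ?_ ?_
  · simp [constants]
  · have : (baseMap k L).appLE ⊤ ⊤ le_top = (baseMap k L).appTop := by
      simp [Scheme.Hom.appLE]
      rfl
    rw [this]
    exact Scheme.ΓSpecIso_naturality _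
  · simp [Scheme.Hom.appLE]
  · simp [constants]

variable (L) in
lemma isStandardSmooth_constants_toSpec {V : X.C.Opens} (hV : IsAffineOpen V)
    (hs : (constants X.str V).hom.IsStandardSmoothOfRelativeDimension 1) :
    (constants (X.toSpec L) (X.toC L ⁻¹ᵁ V)).hom.IsStandardSmoothOfRelativeDimension 1 := by
  have := (RingHom.isStableUnderCobaseChange_toMorphismProperty_iff).2
    (RingHom.isStandardSmoothOfRelativeDimension_isStableUnderBaseChange 1)
  exact this.of_isPushout (isPushout_constants (L := L) hV).flip hs

end PointedCurve

/-! ### The endomorphism `σ` and the subsets of `C_L` almost stable under it. -/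

namespace PointedCurve

open CurveAlgebra

variable {k : Type u} [Field k] {X : PointedCurve k} {L : Type u} [Field L] [Algebra k L]

/-- A point closed in a chart is locally closed in `C`, and in a Jacobson space such a point is
closed. -/
lemma isClosed_fromSpec {V : X.C.Opens} (hV : IsAffineOpen V) {P : PrimeSpectrum Γ(X.C, V)}
    (hP : P.asIdeal.IsMaximal) : IsClosed {hV.fromSpec P} := by
  refine isClosed_singleton_of_isLocallyClosed_singleton ?_
  have h := ((PrimeSpectrum.isClosed_singleton_iff_isMaximal P).2 hP).isLocallyClosed
  have h' := h.image hV.fromSpec.isOpenEmbedding.isInducing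
    hV.fromSpec.isOpenEmbedding.isOpen_range.isLocallyClosed
  have himage : (hV.fromSpec '' {P} : Set X.C) = {hV.fromSpec P} := Set.image_singleton
  exact himage ▸ h'

variable [Fintype k]

variable (X L) in
lemma sigma_toC : X.sigma L ≫ X.toC L = X.toC L := pullback.lift_fst _ _ _

variable (X L) in
lemma sigma_toSpec : X.sigma L ≫ X.toSpec L = X.toSpec L ≫ frobSpec k L := pullback.lift_snd _ _ _

lemma toC_sigma (x : X.CL L) : X.toC L (X.sigma L x) = X.toC L x := by
  rw [← Scheme.Hom.comp_apply, sigma_toC]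

lemma le_sigma_preimage (V : X.C.Opens) :
    X.toC L ⁻¹ᵁ V ≤ X.sigma L ⁻¹ᵁ (X.toC L ⁻¹ᵁ V) := fun x hx => by
  change X.toC L (X.sigma L x) ∈ V
  rw [toC_sigma]
  exact hx

variable (L) in
/-- The endomorphism of `Γ(C_L, V_L)` induced by `σ`, where `V` is an open subset of `C`. -/
def sigmaApp (V : X.C.Opens) : Γ(X.CL L, X.toC L ⁻¹ᵁ V) ⟶ Γ(X.CL L, X.toC L ⁻¹ᵁ V) :=
  (X.sigma L).appLE _ _ (le_sigma_preimage V)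

lemma app_sigmaApp (V : X.C.Opens) : (X.toC L).app V ≫ sigmaApp L V = (X.toC L).app V := by
  have h := Scheme.Hom.appLE_comp_appLE (X.sigma L) (X.toC L) V (X.toC L ⁻¹ᵁ V) (X.toC L ⁻¹ᵁ V)
    le_rfl (le_sigma_preimage V)
  rw [Scheme.Hom.app_eq_appLE]
  refine h.trans ?_
  congr 1
  exact sigma_toC X L

lemma constants_sigmaApp (V : X.C.Opens) :
    constants (X.toSpec L) (X.toC L ⁻¹ᵁ V) ≫ sigmaApp L V =
      CommRingCat.ofHom (FiniteField.frobeniusAlgHom k L).toRingHom ≫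
        constants (X.toSpec L) (X.toC L ⁻¹ᵁ V) := by
  have h := Scheme.Hom.appLE_comp_appLE (X.sigma L) (X.toSpec L) ⊤ (X.toC L ⁻¹ᵁ V)
    (X.toC L ⁻¹ᵁ V) le_top (le_sigma_preimage V)
  have h' := Scheme.Hom.appLE_comp_appLE (X.toSpec L) (frobSpec k L) ⊤ ⊤
    (X.toC L ⁻¹ᵁ V) le_top le_top
  have h2 : (X.sigma L ≫ X.toSpec L).appLE ⊤ (X.toC L ⁻¹ᵁ V) le_top =
      (X.toSpec L ≫ frobSpec k L).appLE ⊤ (X.toC L ⁻¹ᵁ V) le_top := by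
    congr 1
    exact sigma_toSpec X L
  have h3 : (frobSpec k L).appLE ⊤ ⊤ le_top = (frobSpec k L).appTop := by
    simp [Scheme.Hom.appLE]
    rfl
  rw [constants, Category.assoc]
  refine (congrArg ((Scheme.ΓSpecIso (.of L)).inv ≫ ·) (h.trans (h2.trans h'.symm))).trans ?_
  rw [h3]
  exact (Scheme.ΓSpecIso_inv_naturality_assoc
    (CommRingCat.ofHom (FiniteField.frobeniusAlgHom k L).toRingHom) _).symm

/-- A nowhere dense subset of `C_L` which is stable under `σ`, except possibly at one point, lies
over finitely many closed points of each affine piece of `C`. -/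
lemma finite_image_toC {V : X.C.Opens} (hV : IsAffineOpen V)
    (hs : (constants X.str V).hom.IsStandardSmoothOfRelativeDimension 1)
    {S T : Set (X.CL L)} (hT : T.Subsingleton)
    (hST : ∀ x, X.toC L x ∈ V → x ∉ T → (x ∈ S ↔ X.sigma L x ∈ S))
    {U : (X.CL L).Opens} (hU : (U : Set (X.CL L)).Nonempty) (hUS : ∀ x ∈ U, x ∉ S) :
    (X.toC L '' (S ∩ X.toC L ⁻¹' V)).Finite ∧
      ∀ y ∈ X.toC L '' (S ∩ X.toC L ⁻¹' V), IsClosed {y} := by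
  have : IsAffineHom (X.toC L) := 
    MorphismProperty.of_isPullback (P := @IsAffineHom)
      (IsPullback.of_hasPullback X.str (baseMap k L)).flip inferInstance
  let W := X.toC L ⁻¹ᵁ V
  have hW : IsAffineOpen W := hV.preimage (X.toC L)
  by_cases hne : Nonempty W
  swap
  · have hempty : S ∩ X.toC L ⁻¹' V = ∅ := by
      rw [Set.eq_empty_iff_forall_notMem]
      exact fun x hx => hne ⟨⟨x, hx.2⟩⟩
    simp [hempty]
  have hdom : IsDomain Γ(X.CL L, W) := inferInstance
  let S' : Set (PrimeSpectrum Γ(X.CL L, W)) := hW.fromSpec ⁻¹' S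
  let T' : Set (PrimeSpectrum Γ(X.CL L, W)) := hW.fromSpec ⁻¹' T
  let U' : Set (PrimeSpectrum Γ(X.CL L, W)) := hW.fromSpec ⁻¹' U
  have hT' : T'.Subsingleton := hT.preimage hW.fromSpec.isOpenEmbedding.injective
  have hσ (P : PrimeSpectrum Γ(X.CL L, W)) :
      hW.fromSpec (PrimeSpectrum.comap (sigmaApp L V).hom P) = X.sigma L (hW.fromSpec P) :=
    congrArg (fun g : Spec _ ⟶ X.CL L => g P)
      (IsAffineOpen.SpecMap_appLE_fromSpec (X.sigma L) hW hW (le_sigma_preimage V))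
  have hC (P : PrimeSpectrum Γ(X.CL L, W)) :
      hV.fromSpec (PrimeSpectrum.comap ((X.toC L).app V).hom P) = X.toC L (hW.fromSpec P) := by
    rw [Scheme.Hom.app_eq_appLE]
    exact congrArg (fun g : Spec _ ⟶ X.C => g P)
      (IsAffineOpen.SpecMap_appLE_fromSpec (X.toC L) hV hW le_rfl)
  have hmem (P : PrimeSpectrum Γ(X.CL L, W)) : hW.fromSpec P ∈ W := by
    have : hW.fromSpec P ∈ Set.range hW.fromSpec := ⟨P, rfl⟩
    rwa [hW.range_fromSpec] at this
  have hST' (P) (hP : P ∉ T') : P ∈ S' ↔ PrimeSpectrum.comap (sigmaApp L V).hom P ∈ S' := by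
    change _ ↔ hW.fromSpec _ ∈ S
    rw [hσ]
    exact hST _ (hmem P) hP
  -- If this ideal were zero, `S'` would be dense; but by irreducibility the open `U`, which avoids
  -- `S`, meets `W`.
  have hJ : PrimeSpectrum.vanishingIdeal S' ≠ ⊥ := by
    intro h0
    have hcl : closure S' = Set.univ := by
      rw [← PrimeSpectrum.zeroLocus_vanishingIdeal_eq_closure, h0]
      exact PrimeSpectrum.zeroLocus_bot
    have hopen : IsOpen U' := U.isOpen.preimage hW.fromSpec.continuous
    have hsub : closure S' ⊆ U'ᶜ :=
      closure_minimal (fun P hP hPU => hUS _ hPU hP) hopen.isClosed_compl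
    obtain ⟨x, hxU, hxW⟩ := nonempty_preirreducible_inter U.isOpen W.isOpen hU
      ⟨_, hne.some.2⟩
    rw [← hW.range_fromSpec] at hxW
    obtain ⟨P, rfl⟩ := hxW
    exact hsub (hcl ▸ Set.mem_univ P) hxU
  obtain ⟨h1, h2⟩ := finite_and_isMaximal_comap (isPushout_constants (L := L) hV)
    (isStandardSmooth_constants_toSpec L hV hs) (sigmaApp L V) (app_sigmaApp V)
    (constants_sigmaApp V) hJ (S := S') (T := T')
    (fun P hP b hb => (PrimeSpectrum.mem_vanishingIdeal _ _).1 hb P hP) hT' hST'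
  have himage : X.toC L '' (S ∩ X.toC L ⁻¹' V) =
      (fun P => hV.fromSpec (PrimeSpectrum.comap ((X.toC L).app V).hom P)) '' S' := by
    ext y
    constructor
    · rintro ⟨x, ⟨hxS, hxV⟩, rfl⟩
      have hxW : x ∈ (W : Set (X.CL L)) := hxV
      rw [← hW.range_fromSpec] at hxW
      obtain ⟨P, rfl⟩ := hxW
      exact ⟨P, hxS, hC P⟩
    · rintro ⟨P, hP, rfl⟩
      exact ⟨hW.fromSpec P, ⟨hP, hmem P⟩, (hC P).symm⟩
  rw [himage]
  refine ⟨h1.image _, ?_⟩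
  rintro _ ⟨P, hP, rfl⟩
  exact isClosed_fromSpec hV (h2 P hP)

/-- A nowhere dense subset of `C_L` which is stable under `σ` away from `∞` and one further
point lies over a finite closed subset of `C`. -/
lemma exists_finite_isClosed {S T : Set (X.CL L)} (hT : T.Subsingleton)
    (hST : ∀ x, X.toC L x ≠ X.inftyPt → x ∉ T → (x ∈ S ↔ X.sigma L x ∈ S))
    {U : (X.CL L).Opens} (hU : (U : Set (X.CL L)).Nonempty) (hUS : ∀ x ∈ U, x ∉ S) :
    ∃ D : Set X.C, D.Finite ∧ IsClosed D ∧ X.inftyPt ∈ D ∧ S ⊆ X.toC L ⁻¹' D := by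
  let O : X.C.Opens := ⟨{X.inftyPt}ᶜ, X.isClosed_inftyPt.isOpen_compl⟩
  have hchart (y : O) := exists_isStandardSmooth X.str (n := 1) (y : X.C) O y.2
  choose V hV hyV hVO hs using hchart
  have hcomp : IsCompact (O : Set X.C) := TopologicalSpace.NoetherianSpace.isCompact _
  obtain ⟨t, ht⟩ := hcomp.elim_finite_subcover (fun y => (V y : Set X.C)) (fun y => (V y).isOpen)
    (fun y hy => Set.mem_iUnion.2 ⟨⟨y, hy⟩, hyV _⟩)
  have key (y : O) := finite_image_toC (hV y) (hs y) hT
    (fun x hx => hST x (hVO y hx)) hU hUS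
  -- The charts cover only the complement of `∞`, so `∞` is added to `D` outright.
  have hfin : ({X.inftyPt} ∪ ⋃ y ∈ t, X.toC L '' (S ∩ X.toC L ⁻¹' V y)).Finite :=
    (Set.finite_singleton _).union (t.finite_toSet.biUnion fun y _ => (key y).1)
  refine ⟨_, hfin, ?_, Or.inl rfl, fun x hx => ?_⟩
  · refine X.isClosed_inftyPt.union (t.finite_toSet.isClosed_biUnion fun y _ => ?_)
    rw [← Set.biUnion_of_singleton (X.toC L '' (S ∩ X.toC L ⁻¹' V y))]
    exact (key y).1.isClosed_biUnion (key y).2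
  · by_cases hx' : X.toC L x = X.inftyPt
    · exact Or.inl hx'
    · obtain ⟨y, hy, hxy⟩ := Set.mem_iUnion₂.1 (ht hx')
      exact Or.inr (Set.mem_iUnion₂.2 ⟨y, hy, x, ⟨hx, hxy⟩, rfl⟩)

end PointedCurve

/-! ### Stalks of ideal sheaves and determinants of stalk maps. -/

namespace ModulesAux

variable {Y : Scheme.{u}} {M N : Y.Modules}

lemma exists_affineOpens_le (x : Y) (O : Y.Opens) (hx : x ∈ O) :
    ∃ U : Y.affineOpens, x ∈ U.1 ∧ U.1 ≤ O := by
  obtain ⟨_, ⟨U, hU, rfl⟩, hxU, hUO⟩ :=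
    Y.isBasis_affineOpens.exists_subset_of_mem_open (show x ∈ (O : Set Y) from hx) O.isOpen
  exact ⟨⟨U, hU⟩, hxU, hUO⟩

/-- The stalk of an ideal sheaf. -/
def idealStalk (I : Y.IdealSheafData) (x : Y) : Ideal (Y.presheaf.stalk x) :=
  (I.ideal (exists_affineOpens_le x ⊤ trivial).choose).map
    (Y.presheaf.germ _ x (exists_affineOpens_le x ⊤ trivial).choose_spec.1).hom

variable (I : Y.IdealSheafData) (x : Y)

lemma map_germ_eq_of_le {U V : Y.affineOpens} (hV : x ∈ V.1) (h : V ≤ U) :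
    (I.ideal U).map (Y.presheaf.germ U.1 x (h hV)).hom =
      (I.ideal V).map (Y.presheaf.germ V.1 x hV).hom := by
  have hg : Y.presheaf.germ U.1 x (h hV) =
      Y.presheaf.map (homOfLE (X := Y.Opens) h).op ≫ Y.presheaf.germ V.1 x hV :=
    (Y.presheaf.germ_res (homOfLE (X := Y.Opens) h) x hV).symm
  rw [← I.map_ideal h, Ideal.map_map, hg, CommRingCat.hom_comp]
  rfl

/-- Any two affine neighbourhoods contain a common smaller one, so the chart chosen in the
definition is immaterial. -/
lemma idealStalk_eq {U : Y.affineOpens} (hU : x ∈ U.1) :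
    idealStalk I x = (I.ideal U).map (Y.presheaf.germ U.1 x hU).hom := by
  have h0 := (exists_affineOpens_le x ⊤ trivial).choose_spec.1
  obtain ⟨W, hW, hle⟩ := exists_affineOpens_le x
    ((exists_affineOpens_le x ⊤ trivial).choose.1 ⊓ U.1) ⟨h0, hU⟩
  rw [idealStalk, map_germ_eq_of_le I x hW (fun y hy => (hle hy).1),
    map_germ_eq_of_le I x hW (fun y hy => (hle hy).2)]

lemma idealStalk_pow (n : ℕ) : idealStalk (I ^ n) x = idealStalk I x ^ n := by
  obtain ⟨U, hU, -⟩ := exists_affineOpens_le x ⊤ trivial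
  rw [idealStalk_eq _ x hU, idealStalk_eq _ x hU, ← Ideal.map_pow]
  rfl

lemma idealStalk_eq_top_iff : idealStalk I x = ⊤ ↔ x ∉ I.support := by
  obtain ⟨U, hU, -⟩ := exists_affineOpens_le x ⊤ trivial
  rw [idealStalk_eq _ x hU, Scheme.IdealSheafData.mem_support_iff_of_mem hU,
    Scheme.mem_zeroLocus_iff]
  push Not
  constructor
  · intro h
    by_contra! hb
    have hle : (I.ideal U).map (Y.presheaf.germ U.1 x hU).hom ≤
        IsLocalRing.maximalIdeal (Y.presheaf.stalk x) := by
      rw [Ideal.map_le_iff_le_comap]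
      intro b hbI
      rw [Ideal.mem_comap, IsLocalRing.mem_maximalIdeal]
      exact fun hunit => hb b hbI ((Y.mem_basicOpen _ _ hU).2 hunit)
    rw [h, top_le_iff] at hle
    exact Ideal.IsPrime.ne_top' hle
  · rintro ⟨b, hbI, hb⟩
    exact Ideal.eq_top_of_isUnit_mem _ (Ideal.mem_map_of_mem _ hbI)
      ((Y.mem_basicOpen _ _ hU).1 hb)

variable {I} {x}

lemma ImageEqIdealMul.range_stalkLin {φ : M ⟶ N} (h : ImageEqIdealMul φ I) (x : Y) :
    LinearMap.range (stalkLin φ x) = idealStalk I x • (⊤ : Submodule _ (N.presheaf.stalk x)) := by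
  refine le_antisymm ?_ ?_
  · rintro _ ⟨m, rfl⟩
    obtain ⟨V, hxV, t, rfl⟩ := M.presheaf.exists_germ_eq m
    obtain ⟨U, hxU, hUV⟩ := exists_affineOpens_le x V hxV
    rw [stalkLin_apply, ← M.presheaf.germ_res_apply (homOfLE hUV) x hxU, stalkMap_germ]
    have hmem := (h U _).1 ⟨M.presheaf.map (homOfLE hUV).op t, rfl⟩
    refine Submodule.smul_induction_on (p := fun s =>
      N.presheaf.germ U.1 x hxU s ∈ idealStalk I x • (⊤ : Submodule _ (N.presheaf.stalk x)))
      hmem ?_ ?_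
    · intro a ha s _
      rw [germ_smul]
      refine Submodule.smul_mem_smul ?_ trivial
      rw [idealStalk_eq I x hxU]
      exact Ideal.mem_map_of_mem _ ha
    · intro s s' hs hs'
      rw [map_add]
      exact add_mem hs hs'
  · rw [Submodule.smul_le]
    intro a ha n _
    obtain ⟨V, hxV, s, rfl⟩ := N.presheaf.exists_germ_eq n
    obtain ⟨U, hxU, hUV⟩ := exists_affineOpens_le x V hxV
    rw [idealStalk_eq I x hxU] at ha
    rw [← N.presheaf.germ_res_apply (homOfLE hUV) x hxU]
    induction ha using Submodule.span_induction with
    | mem a ha =>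
      obtain ⟨b, hb, rfl⟩ := ha
      obtain ⟨t, ht⟩ := (h U (b • N.presheaf.map (homOfLE hUV).op s)).2
        (Submodule.smul_mem_smul hb trivial)
      refine ⟨M.presheaf.germ U.1 x hxU t, ?_⟩
      rw [stalkLin_apply, stalkMap_germ, ht, germ_smul]
    | zero =>
      rw [zero_smul]
      exact zero_mem _
    | add a b _ _ ha hb =>
      rw [add_smul]
      exact add_mem ha hb
    | smul c a _ ha =>
      rw [smul_assoc]
      exact Submodule.smul_mem _ c ha

lemma ImageEqIdealMul.stalkMap_surjective {φ : M ⟶ N} (h : ImageEqIdealMul φ I)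
    (hx : idealStalk I x = ⊤) : Function.Surjective (stalkMap φ x) := by
  have hr := h.range_stalkLin x
  rw [hx, Submodule.top_smul] at hr
  exact LinearMap.range_eq_top.1 hr

lemma IsAnnihilatedBy.notMem_support (h : IsAnnihilatedBy M I) (hx : idealStalk I x = ⊤) :
    x ∉ support M := by
  rw [support, Set.mem_ofPred_eq, not_nontrivial_iff_subsingleton]
  refine subsingleton_of_forall_eq 0 fun m => ?_
  obtain ⟨V, hxV, s, rfl⟩ := M.presheaf.exists_germ_eq m
  obtain ⟨U, hxU, hUV⟩ := exists_affineOpens_le x V hxV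
  have h1 : (1 : Y.presheaf.stalk x) ∈ idealStalk I x := hx ▸ trivial
  rw [idealStalk_eq I x hxU] at h1
  rw [← M.presheaf.germ_res_apply (homOfLE hUV) x hxU, ← one_smul (Y.presheaf.stalk x)
    (M.presheaf.germ U.1 x hxU _)]
  generalize (1 : Y.presheaf.stalk x) = a at h1
  induction h1 using Submodule.span_induction with
  | mem a ha =>
    obtain ⟨b, hb, rfl⟩ := ha
    refine (germ_smul M x U.1 hxU b _).symm.trans ?_
    rw [h U b hb, map_zero]
  | zero => rw [zero_smul]
  | add a b _ _ ha hb => rw [add_smul, ha, hb, add_zero]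
  | smul c a _ ha => rw [smul_assoc, ha, smul_zero]

/-- The determinant of the map on stalks of a map between locally free modules of the same rank,
with respect to some bases. -/
def stalkDet {r : ℕ} (hM : IsLocallyFreeOfRank M r) (hN : IsLocallyFreeOfRank N r) (φ : M ⟶ N)
    (x : Y) : Y.presheaf.stalk x :=
  (LinearMap.toMatrix (hM.basis x) (hN.basis x) (stalkLin φ x)).det

/-- The basis of a stalk is fixed by sheaf, rank and point, so the two middle bases agree and
multiplicativity is exact, not merely up to units. -/
lemma stalkDet_comp {r : ℕ} {K : Y.Modules} (hM : IsLocallyFreeOfRank M r)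
    (hN : IsLocallyFreeOfRank N r) (hK : IsLocallyFreeOfRank K r) (φ : M ⟶ N) (ψ : N ⟶ K) (x : Y) :
    stalkDet hM hK (φ ≫ ψ) x = stalkDet hN hK ψ x * stalkDet hM hN φ x := by
  have : stalkLin (φ ≫ ψ) x = stalkLin ψ x ∘ₗ stalkLin φ x :=
    LinearMap.ext (stalkMap_comp_apply φ ψ x)
  rw [stalkDet, this, LinearMap.toMatrix_comp _ (hN.basis x), Matrix.det_mul]
  rfl

lemma stalkDet_id {r : ℕ} (hM : IsLocallyFreeOfRank M r) (x : Y) :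
    stalkDet hM hM (𝟙 M) x = 1 := by
  have : stalkLin (𝟙 M) x = LinearMap.id :=
    LinearMap.ext fun m => ConcreteCategory.congr_hom ((stalkFun x).map_id M) m
  rw [stalkDet, this, LinearMap.toMatrix_id, Matrix.det_one]

lemma stalkDet_ne_zero [IsIntegral Y] {r : ℕ} (hM : IsLocallyFreeOfRank M r)
    (hN : IsLocallyFreeOfRank N r) (φ : M ⟶ N) [Mono φ] (x : Y) : stalkDet hM hN φ x ≠ 0 := by
  intro h0
  obtain ⟨v, hv, hv'⟩ := Matrix.exists_mulVec_eq_zero_iff.2 h0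
  refine hv ?_
  have hinj : Function.Injective (stalkLin φ x) := stalkMap_injective_of_mono φ x
  have h1 : stalkLin φ x ((hM.basis x).equivFun.symm v) = 0 := by
    refine (hN.basis x).equivFun.injective ?_
    have h2 := LinearMap.toMatrix_mulVec_repr (hM.basis x) (hN.basis x) (stalkLin φ x)
      ((hM.basis x).equivFun.symm v)
    rw [← Module.Basis.equivFun_apply, LinearEquiv.apply_symm_apply, hv'] at h2
    rw [map_zero, Module.Basis.equivFun_apply, ← h2]
  exact (hM.basis x).equivFun.symm.injective
    ((hinj (h1.trans (map_zero _).symm)).trans (map_zero _).symm)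

lemma span_stalkDet {r : ℕ} (hM : IsLocallyFreeOfRank M r)
    (hN : IsLocallyFreeOfRank N r) {φ : M ⟶ N} (h : ImageEqIdealMul φ I) (x : Y) :
    Ideal.span {stalkDet hM hN φ x} = idealStalk I x ^ r :=
  CurveAlgebra.span_det_toMatrix _ _ _ _ (h.range_stalkLin x)

lemma rank_eq_of_bijective {r r' : ℕ} (hM : IsLocallyFreeOfRank M r)
    (hN : IsLocallyFreeOfRank N r') (φ : M ⟶ N) (x : Y)
    (h : Function.Bijective (stalkMap φ x)) : r = r' := by
  have := ((LinearEquiv.ofBijective (stalkLin φ x) h).finrank_eq)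
  rwa [Module.finrank_eq_card_basis (hM.basis x), Module.finrank_eq_card_basis (hN.basis x),
    Fintype.card_fin, Fintype.card_fin] at this

lemma surjective_genericPoint_of_injective [IsIntegral Y] {r : ℕ} (hM : IsLocallyFreeOfRank M r)
    (hN : IsLocallyFreeOfRank N r) (φ : M ⟶ N)
    (h : Function.Injective (stalkMap φ (genericPoint Y))) :
    Function.Surjective (stalkMap φ (genericPoint Y)) := by
  let : Field (Y.presheaf.stalk (genericPoint Y)) := inferInstanceAs (Field Y.functionField)
  have := Module.Finite.of_basis (hM.basis (genericPoint Y))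
  have := Module.Finite.of_basis (hN.basis (genericPoint Y))
  refine (LinearMap.injective_iff_surjective_of_finrank_eq_finrank
    (f := stalkLin φ (genericPoint Y)) ?_).1 h
  rw [Module.finrank_eq_card_basis (hM.basis _), Module.finrank_eq_card_basis (hN.basis _)]

/-- On an integral scheme the stalks of a locally free sheaf embed into its generic stalk,
compatibly with `φ`. -/
lemma mono_of_injective_genericPoint [IsIntegral Y] {r : ℕ} (hM : IsLocallyFreeOfRank M r)
    (φ : M ⟶ N) (h : Function.Injective (stalkMap φ (genericPoint Y))) : Mono φ := by
  refine mono_of_stalkMap_injective φ fun x => ?_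
  have hs : genericPoint Y ⤳ x := (genericPoint_spec Y).specializes trivial
  have hM' := hM.injective_specialize hs
    (IsFractionRing.injective (Y.presheaf.stalk x) Y.functionField)
  intro m m' hmm
  refine hM' (h ?_)
  have hnat := TopCat.Presheaf.stalkSpecializes_stalkFunctor_map φ.mapPresheaf hs
  have hnat' (a : M.presheaf.stalk x) := ConcreteCategory.congr_hom hnat a
  exact ((hnat' m).trans (congrArg (N.presheaf.stalkSpecializes hs) hmm)).trans (hnat' m').symm

lemma rank_eq_zero_of_isZero [Nonempty Y] {r : ℕ} (hM : IsLocallyFreeOfRank M r)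
    (h : IsZero M) : r = 0 := by
  obtain ⟨x⟩ := ‹Nonempty Y›
  have : Subsingleton (M.presheaf.stalk x) :=
    AddCommGrpCat.subsingleton_of_isZero ((stalkFun x).map_isZero h)
  by_contra hr
  have := (hM.basis x).ne_zero ⟨0, Nat.pos_of_ne_zero hr⟩
  exact this (Subsingleton.elim _ _)

end ModulesAux

/-! ### Application to abelian `τ`-sheaves. -/

namespace AbelianTauSheaf

open ModulesAux PointedCurve

section Infinity

variable {k : Type u} [Field k] {X : PointedCurve k} {L : Type u} [Field L] [Algebra k L]

lemma idealStalk_inftyPoint_pow {x : X.CL L} (hx : X.toC L x ≠ X.inftyPt) (m : ℕ) :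
    idealStalk ((X.inftyPoint L).graphIdeal ^ m) x = ⊤ := by
  rw [idealStalk_pow, (idealStalk_eq_top_iff _ x).2 fun h => hx (toC_of_mem_support h),
    Ideal.top_pow]

variable (X L) in
lemma toC_genericPoint_ne : X.toC L (genericPoint (X.CL L)) ≠ X.inftyPt :=
  X.toC_genericPoint_notMem (Set.finite_singleton _) X.isClosed_inftyPt

end Infinity

variable {k : Type u} [Field k] [Fintype k] {X : PointedCurve k}
  {L : Type u} [Field L] [Algebra k L] {c : X.Point L}

section Basic

variable (F : AbelianTauSheaf c)

/-- The zero sheaf has rank `0`, and division by `0` gives `0`, so the two cases agree. -/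
lemma weight_eq : F.weight = (F.dim : ℚ) / (F.rank : ℚ) := by
  classical
  rw [weight]
  split_ifs with h
  · rw [rank_eq_zero_of_isZero (F.locallyFree 0) (h 0), Nat.cast_zero, div_zero]
  · rfl

lemma map_refl (i : ℤ) : F.sheaf.map (homOfLE (le_refl i)) = 𝟙 _ :=
  (congrArg F.sheaf.map (Subsingleton.elim _ _)).trans (F.sheaf.map_id i)

lemma mono_map {i j : ℤ} (h : i ≤ j) : Mono (F.sheaf.map (homOfLE h)) := by
  induction j, h using Int.leInduction with
  | base =>
    rw [map_refl]
    infer_instance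
  | succ j h ih =>
    have := F.pi_injective j
    rw [← homOfLE_comp h (Int.le_add_one le_rfl : j ≤ j + 1), F.sheaf.map_comp]
    infer_instance

lemma pi_bijective {x : X.CL L} (hx : X.toC L x ≠ X.inftyPt) (i : ℤ) :
    Function.Bijective (stalkMap
      (F.sheaf.map (homOfLE (Int.le_add_one le_rfl : i ≤ i + 1))) x) := by
  have := F.pi_injective i
  refine ⟨stalkMap_injective_of_mono _ x, ?_⟩
  obtain ⟨m, l, -, hl, -, h⟩ := F.periodic
  have key (a b : ℤ) (hab : b = a + l) (hle : a ≤ b) :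
      Function.Surjective (stalkMap (F.sheaf.map (homOfLE hle)) x) := by
    subst hab
    exact (h a).stalkMap_surjective (idealStalk_inftyPoint_pow hx m)
  -- The full period ending at `i + 1` is onto and has `Π_i` as its last factor.
  have hsurj := key (i + 1 - l) (i + 1) (by ring) (by omega)
  rw [← homOfLE_comp (by omega : i + 1 - l ≤ i) (Int.le_add_one le_rfl : i ≤ i + 1),
    F.sheaf.map_comp, stalkMap_comp] at hsurj
  exact Function.Surjective.of_comp hsurj

/-- Off the graph of `c` the annihilating ideal is the unit ideal, so the cokernel has zero stalk.
-/
lemma tau_bijective {x : X.CL L} (hx : x ∉ c.graphIdeal.support) (i : ℤ) :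
    Function.Bijective (stalkMap (F.tau i) x) := by
  have := F.tau_injective i
  refine ⟨stalkMap_injective_of_mono _ x, ?_⟩
  rw [← notMem_support_cokernel_iff]
  refine (F.tau_coker_annihilated i).notMem_support ?_
  rw [idealStalk_pow, (idealStalk_eq_top_iff _ x).2 hx, Ideal.top_pow]

end Basic

variable {F F' : AbelianTauSheaf c} (f : Hom F F')

lemma Hom.map_comm {i j : ℤ} (h : i ≤ j) :
    F.sheaf.map (homOfLE h) ≫ f.app j = f.app i ≫ F'.sheaf.map (homOfLE h) := by
  induction j, h using Int.leInduction with
  | base => rw [map_refl, map_refl, Category.id_comp, Category.comp_id]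
  | succ j h ih =>
    rw [← homOfLE_comp h (Int.le_add_one le_rfl : j ≤ j + 1), F.sheaf.map_comp, F'.sheaf.map_comp,
      Category.assoc, f.pi_comm, reassoc_of% ih]

lemma Hom.stalkMap_pi_comm (i : ℤ) (x : X.CL L) (m) :
    stalkMap (f.app (i + 1)) x (stalkMap
        (F.sheaf.map (homOfLE (Int.le_add_one le_rfl : i ≤ i + 1))) x m) =
      stalkMap (F'.sheaf.map (homOfLE (Int.le_add_one le_rfl : i ≤ i + 1))) x
        (stalkMap (f.app i) x m) := by
  rw [← stalkMap_comp_apply, ← stalkMap_comp_apply, f.pi_comm]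

lemma Hom.surjective_add_one_iff {x : X.CL L} (hx : X.toC L x ≠ X.inftyPt) (i : ℤ) :
    Function.Surjective (stalkMap (f.app (i + 1)) x) ↔
      Function.Surjective (stalkMap (f.app i) x) := by
  have h : ⇑(stalkMap (f.app (i + 1)) x) ∘ _ = _ ∘ ⇑(stalkMap (f.app i) x) :=
    funext (f.stalkMap_pi_comm i x)
  rw [← (F.pi_bijective hx i).surjective.of_comp_iff, h,
    Function.Surjective.of_comp_iff' (F'.pi_bijective hx i)]

lemma Hom.injective_add_one_iff {x : X.CL L} (hx : X.toC L x ≠ X.inftyPt) (i : ℤ) :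
    Function.Injective (stalkMap (f.app (i + 1)) x) ↔
      Function.Injective (stalkMap (f.app i) x) := by
  have h : ⇑(stalkMap (f.app (i + 1)) x) ∘ _ = _ ∘ ⇑(stalkMap (f.app i) x) :=
    funext (f.stalkMap_pi_comm i x)
  rw [← Function.Injective.of_comp_iff' _ (F.pi_bijective hx i), h,
    (F'.pi_bijective hx i).injective.of_comp_iff]

lemma iff_of_iff_add_one {P : ℤ → Prop} (h : ∀ i, P (i + 1) ↔ P i) (i j : ℤ) : P i ↔ P j := by
  suffices H : ∀ i, P i ↔ P 0 from (H i).trans (H j).symm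
  intro i
  induction i using Int.induction_on with
  | zero => rfl
  | succ i ih => rw [h, ih]
  | pred i ih => rw [← h, sub_add_cancel, ih]

lemma Hom.surjective_iff {x : X.CL L} (hx : X.toC L x ≠ X.inftyPt) (i j : ℤ) :
    Function.Surjective (stalkMap (f.app i) x) ↔ Function.Surjective (stalkMap (f.app j) x) :=
  iff_of_iff_add_one (P := fun i => Function.Surjective (stalkMap (f.app i) x))
    (f.surjective_add_one_iff hx) i j

lemma Hom.injective_iff {x : X.CL L} (hx : X.toC L x ≠ X.inftyPt) (i j : ℤ) :
    Function.Injective (stalkMap (f.app i) x) ↔ Function.Injective (stalkMap (f.app j) x) :=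
  iff_of_iff_add_one (P := fun i => Function.Injective (stalkMap (f.app i) x))
    (f.injective_add_one_iff hx) i j

lemma Hom.isIso_genericFiber_iff (i : ℤ) :
    IsIso (f.genericFiber i) ↔ Function.Bijective (stalkMap (f.app i) (genericPoint (X.CL L))) :=
  ConcreteCategory.isIso_iff_bijective _

/-- Away from `∞` and the characteristic, the locus where `f` is not surjective is stable under
`σ`. -/
lemma Hom.surjective_sigma_iff (hr : F.rank = F'.rank) {x : X.CL L} (hx : X.toC L x ≠ X.inftyPt)
    (hxc : x ∉ c.graphIdeal.support) (i : ℤ) :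
    Function.Surjective (stalkMap (f.app i) x) ↔
      Function.Surjective (stalkMap (f.app i) (X.sigma L x)) := by
  -- Surjectivity of `f_i` at `σ x` is that of `σ^* f_i` at `x`, which the `τ`'s identify with that
  -- of `f_{i+1}` at `x`; the `Π`'s then lead back to `f_i`.
  rw [← surjective_pullback_iff (hr ▸ F.locallyFree i) (F'.locallyFree i),
    ← f.surjective_add_one_iff hx]
  have h : ⇑(stalkMap (f.app (i + 1)) x) ∘ ⇑(stalkMap (F.tau i) x) = ⇑(stalkMap (F'.tau i) x) ∘
      ⇑(stalkMap ((Scheme.Modules.pullback (X.sigma L)).map (f.app i)) x) := by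
    funext m
    change stalkMap _ x (stalkMap _ x m) = stalkMap _ x (stalkMap _ x m)
    rw [← stalkMap_comp_apply, ← stalkMap_comp_apply, f.tau_comm]
  rw [← (F.tau_bijective hxc i).surjective.of_comp_iff, h,
    Function.Surjective.of_comp_iff' (F'.tau_bijective hxc i)]

/-- An injective morphism between abelian `τ`-sheaves of the same rank is generically an
isomorphism. -/
lemma Hom.bijective_genericPoint (hf : f.Injective) (hr : F.rank = F'.rank) (i : ℤ) :
    Function.Bijective (stalkMap (f.app i) (genericPoint (X.CL L))) := by
  have := hf i
  have hinj := stalkMap_injective_of_mono (f.app i) (genericPoint (X.CL L))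
  exact ⟨hinj,
    surjective_genericPoint_of_injective (hr ▸ F.locallyFree i) (F'.locallyFree i) _ hinj⟩

/-- If there is an injective morphism between abelian `τ`-sheaves of the same rank, then they have
the same dimension. -/
lemma Hom.dim_eq (hf : f.Injective) (hr : F.rank = F'.rank) : F.dim = F'.dim := by
  obtain ⟨m, l, hm, hl, hml, h⟩ := F.periodic
  obtain ⟨m', l', hm', hl', hml', h'⟩ := F'.periodic
  let x : X.CL L := (X.inftyPoint L).graph (IsLocalRing.closedPoint L)
  have hx : x ∈ (X.inftyPoint L).graphIdeal.support := by
    rw [← SetLike.mem_coe, support_graphIdeal]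
    exact ⟨_, rfl⟩
  let I := idealStalk (X.inftyPoint L).graphIdeal x
  have hI : I ≠ ⊤ := fun h => (idealStalk_eq_top_iff _ x).1 h hx
  have hF (i : ℤ) : IsLocallyFreeOfRank (F.sheaf.obj i) F'.rank := hr ▸ F.locallyFree i
  have hF' := F'.locallyFree
  -- The value `0` for `j < i` only makes `p` total; `slope_eq` evaluates it on `i ≤ j` alone.
  let p (i j : ℤ) := if h : i ≤ j then stalkDet (hF i) (hF j) (F.sheaf.map (homOfLE h)) x else 0
  let p' (i j : ℤ) := if h : i ≤ j then stalkDet (hF' i) (hF' j) (F'.sheaf.map (homOfLE h)) x else 0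
  have hp {i j : ℤ} (h : i ≤ j) : p i j = stalkDet (hF i) (hF j) (F.sheaf.map (homOfLE h)) x :=
    dif_pos h
  have hp' {i j : ℤ} (h : i ≤ j) :
      p' i j = stalkDet (hF' i) (hF' j) (F'.sheaf.map (homOfLE h)) x :=
    dif_pos h
  have key := CurveAlgebra.slope_eq (I := I) hI (p := p) (p' := p')
    (δ := fun i => stalkDet (hF i) (hF' i) (f.app i) x) (l := l) (l' := l')
    (s := m * F'.rank) (s' := m' * F'.rank)
    (fun i => by
      rw [hp le_rfl, map_refl, stalkDet_id])
    (fun i => by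
      rw [hp' le_rfl, map_refl, stalkDet_id])
    (fun i j k hij hjk => by
      rw [hp hij, hp hjk, hp (hij.trans hjk), ← stalkDet_comp, ← F.sheaf.map_comp, homOfLE_comp])
    (fun i j k hij hjk => by
      rw [hp' hij, hp' hjk, hp' (hij.trans hjk), ← stalkDet_comp, ← F'.sheaf.map_comp,
        homOfLE_comp])
    (fun i j hij => by
      have := F.mono_map hij
      rw [hp hij]
      exact stalkDet_ne_zero _ _ _ x)
    (fun i j hij => by
      have := F'.mono_map hij
      rw [hp' hij]
      exact stalkDet_ne_zero _ _ _ x)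
    (fun i j hij => by
      rw [hp hij, hp' hij, ← stalkDet_comp, ← stalkDet_comp, f.map_comm])
    (fun i => by
      rw [hp (Int.le_add_of_nonneg_right (Int.natCast_nonneg l)), span_stalkDet _ _ (h i) x,
        idealStalk_pow, ← pow_mul])
    (fun i => by
      rw [hp' (Int.le_add_of_nonneg_right (Int.natCast_nonneg l')), span_stalkDet _ _ (h' i) x,
        idealStalk_pow, ← pow_mul])
    (i := 0) (by
      have := hf 0
      exact stalkDet_ne_zero _ _ _ x)
  rw [hr] at hml
  -- Here `key` says `m r l' = m' r l`; substituting `m r = l d` and `m' r = l' d'` leaves `l l' d =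
  -- l l' d'`.
  rw [← hml, ← hml', mul_right_comm, mul_right_comm l', mul_comm l' l] at key
  exact Nat.eq_of_mul_eq_mul_left (Nat.mul_pos hl hl') key

lemma Hom.exists_finite_isClosed (hf : f.Injective) (hr : F.rank = F'.rank) :
    ∃ D : Set X.C, D.Finite ∧ IsClosed D ∧
      ∀ i : ℤ, ModulesAux.support (cokernel (f.app i)) ⊆ X.toC L ⁻¹' D := by
  obtain ⟨U, hU, hsurj⟩ := exists_open_surjective_of_surjective (f.app 0) (F'.locallyFree 0)
    (genericPoint (X.CL L)) (f.bijective_genericPoint hf hr 0).2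
  obtain ⟨D, hD, hD', hinf, hSD⟩ := PointedCurve.exists_finite_isClosed
    (S := {x | ¬ Function.Surjective (stalkMap (f.app 0) x)})
    (subsingleton_support_graphIdeal c)
    (fun x hx hxc => not_congr (f.surjective_sigma_iff hr hx hxc 0)) (U := U) ⟨_, hU⟩
    (fun x hx hxS => hxS (hsurj x hx))
  refine ⟨D, hD, hD', fun i x hx => ?_⟩
  -- Over `∞` the support may vary with `i`, but `∞ ∈ D`; elsewhere it is the one for `i = 0`.
  by_cases hxi : X.toC L x = X.inftyPt
  · rw [Set.mem_preimage, hxi]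
    exact hinf
  · refine hSD fun hs => ?_
    exact (notMem_support_cokernel_iff (f.app i) x).2 ((f.surjective_iff hxi i 0).2 hs) hx

end AbelianTauSheaf

end

theorem mainTheorem7 {k : Type u} [Field k] [Fintype k] (X : PointedCurve k)
    (L : Type u) [Field L] [Algebra k L] (c : X.Point L)
    (F F' : AbelianTauSheaf c) (f : AbelianTauSheaf.Hom F F') :
    List.TFAE [
      f.Injective ∧ ∃ D : Set X.C, D.Finite ∧ IsClosed D ∧
        ∀ i : ℤ, ModulesAux.support (cokernel (f.app i)) ⊆ X.toC L ⁻¹' D,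
      f.Injective ∧ F.rank = F'.rank ∧ F.dim = F'.dim,
      F.weight = F'.weight ∧ ∃ i : ℤ, IsIso (f.genericFiber i),
      F.weight = F'.weight ∧ ∀ i : ℤ, IsIso (f.genericFiber i)] := by
  tfae_have 1 → 2 := by
    rintro ⟨hf, D, hD, hD', h⟩
    have := hf 0
    have hsurj := (ModulesAux.notMem_support_cokernel_iff (f.app 0) (genericPoint (X.CL L))).1
      fun hx => X.toC_genericPoint_notMem hD hD' (h 0 hx)
    have hr := ModulesAux.rank_eq_of_bijective (F.locallyFree 0) (F'.locallyFree 0) (f.app 0) _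
      ⟨ModulesAux.stalkMap_injective_of_mono _ _, hsurj⟩
    exact ⟨hf, hr, f.dim_eq hf hr⟩
  tfae_have 2 → 1 := fun ⟨hf, hr, _⟩ => ⟨hf, f.exists_finite_isClosed hf hr⟩
  tfae_have 2 → 4 := by
    rintro ⟨hf, hr, hd⟩
    refine ⟨by rw [AbelianTauSheaf.weight_eq, AbelianTauSheaf.weight_eq, hr, hd], fun i => ?_⟩
    exact (f.isIso_genericFiber_iff i).2 (f.bijective_genericPoint hf hr i)
  tfae_have 4 → 3 := fun ⟨hw, h⟩ => ⟨hw, 0, h 0⟩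
  tfae_have 3 → 2 := by
    rintro ⟨hw, i, hi⟩
    have hbij := (f.isIso_genericFiber_iff i).1 hi
    have hr := ModulesAux.rank_eq_of_bijective (F.locallyFree i) (F'.locallyFree i) (f.app i) _ hbij
    -- The generic point does not lie over `∞`, so injectivity there passes from the index `i` to
    -- every `j`.
    have hf : f.Injective := fun j => ModulesAux.mono_of_injective_genericPoint (F.locallyFree j)
      (f.app j) ((f.injective_iff (AbelianTauSheaf.toC_genericPoint_ne X L) j i).2 hbij.1)
    exact ⟨hf, hr, f.dim_eq hf hr⟩
  tfae_finish
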